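/- Let $m>1$, $A\in\mathbb R^{n\times n}$, $C_i\in\mathbb R^{s_i\times n}$ $(i=1,\dots,m)$, and suppose that the pair $(C,A)$ is observable, where $C$ is obtained by stacking $C_1,\dots,C_m$. Let $\mathcal V_i=\bigcap_{k<n}\ker C_iA^k$ be the unobservable space of $(C_i,A)$ and $P_i$ the orthogonal projection on $\mathcal V_i$. Let $Q_i$ be a matrix of full row rank with kernel $\mathcal V_i$, let $Q_i^{-1}$ be a right inverse of $Q_i$, and let $\lambda\in(0,1)$. A *neighbor graph* is a strongly connected directed graph $G$ on $\{1,\dots,m\}$ with an arc from every vertex to itself. For such a graph let $S_G=D_G^{-1}\mathrm{Adj}_G'$, where $D_G$ is the diagonal matrix of in-degrees, and let $\bar S_G=S_G\otimes I_n$. A sequence of matrices $F(\tau)$ converges to zero as fast as $\mu^\tau$ if $\|F(\tau)\|=O(\mu^\tau)$ as $\tau\to\infty$. (1) The equations $Q_iA=\bar A_iQ_i$ and $\bar C_iQ_i=C_i$ have unique solutions $\bar A_i,\bar C_i$, the pair $(\bar C_i,\bar A_i)$ is observable, and there is a matrix $\bar K_i$ for which $(\bar A_i+\bar K_i\bar C_i)^\tau$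 converges to zero as fast as $\lambda^\tau$. Now let $\bar K_i$, $i=1,\dots,m$, be any matrices for which $(\bar A_i+\bar K_i\bar C_i)^\tau$ converges to zero as fast as $\lambda^\tau$, let $K_i=Q_i^{-1}\bar K_i$, $\bar A=\mathrm{blockdiag}\{A+K_iC_i\}$ and $P=\mathrm{blockdiag}\{P_i\}$. For a sequence of neighbor graphs $G(1),G(2),\dots$ and an integer $q\ge 0$ let $$\Phi(\tau)=\prod_{s=1}^{\tau}\bar A\bigl(I-P(I-\bar S_{G(s)})\bigr)^q$$ (factors with larger $s$ stand to the left) be the error transition matrix of the distributed observer. (2) There is $q_0$ such that for every $q\ge q_0$ and every sequence of neighbor graphs, constant or time-varying, $\Phi(\tau)$ converges to zero as fast as $\lambda^\tau$. (3) Suitable $q$ can be found as follows. Let the columns of $V_i$ form any orthonormal basis of $\mathcal V_i$, let $V=\mathrm{blockdiag}\{V_i\}$, $B_G=V'\bar S_GV$, $A_i=V_i'(A+K_iC_i)V_i$ and $\tilde A=\mathrm{blockdiag}\{A_i\}$. Then $(A+K_iC_i)V_i=V_iA_i$, and the following hold. (3a) *Weighted two-norm, constant graph.* Let $G$ be a neighbor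 graph. There is an entrywise positive probability vector $\pi$ with $S_G'\pi=\pi$. For any such $\pi$ the matrix $R=V'(\mathrm{diag}(\pi)\otimes I_n)V$ is positive definite, and the matrix norm $\|\cdot\|_R$ induced by the vector norm $\sqrt{x'Rx}$ satisfies $\|B_G\|_R<1$, $\|\tilde A\|_R\|B_G\|_R^q<\lambda$ for all sufficiently large $q$, and $\|\tilde AB_G^q\|_R\le\|\tilde A\|_R\|B_G\|_R^q$ for all $q$. If $\mu\ge\lambda$ and $\|\tilde AB_G^q\|_R<\mu$, then, for the constant sequence $G(s)=G$, $\Phi(\tau)$ converges to zero as fast as $\mu^\tau$. (3b) *Two-norm, time-varying graph.* For all sufficiently large $p$, $\|B_G^p\|_2<1$ for every neighbor graph $G$. For every $p$ with this property, all sufficiently large $\bar p$ satisfy $\|\tilde A(B_G^p)^{\bar p}\|_2<\lambda$ for every neighbor graph $G$. If $\mu\ge\lambda$ and a sequence of neighbor graphs satisfies $\|\tilde A(B_{G(\tau)}^p)^{\bar p}\|_2<\mu$ for all $\tau$, then with $q=p\bar p$ the matrix $\Phi(\tau)$ converges to zero as fast as $\mu^\tau$. (3c) *Mixed norm, constant or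 time-varying graph.* For a block matrix $M=[M_{ij}]$ let $\|M\|_{\rm mix}=\max_i\sum_j\|M_{ij}\|_2$. For every $p\ge(m-1)^2$, $\|B_G^p\|_{\rm mix}<1$ for every neighbor graph $G$, and all sufficiently large $\bar p$ satisfy $\|\tilde A\|_{\rm mix}\|B_G^p\|_{\rm mix}^{\bar p}<\lambda$ for every neighbor graph $G$. For all $p,\bar p$ and every neighbor graph $G$, $\|\tilde A(B_G^p)^{\bar p}\|_{\rm mix}\le\|\tilde A\|_{\rm mix}\|B_G^p\|_{\rm mix}^{\bar p}$. If $\mu\ge\lambda$ and a sequence of neighbor graphs satisfies $\|\tilde A(B_{G(\tau)}^p)^{\bar p}\|_{\rm mix}<\mu$ for all $\tau$, then with $q=p\bar p$ the matrix $\Phi(\tau)$ converges to zero as fast as $\mu^\tau$. -/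

import Mathlib

open Matrix Filter Asymptotics
-- `‖M‖` denotes the spectral norm (induced two-norm) of a real matrix.
open scoped Matrix.Norms.L2Operator Kronecker

noncomputable section

namespace DistributedObserver

/-- The unobservable space of the pair `(C, A)`: the kernel of the observability matrix with
block rows `C, CA, …, CA^{n-1}`. -/
def unobservableSpace {n : ℕ} {ι : Type*} [Fintype ι] (A : Matrix (Fin n) (Fin n) ℝ)
    (C : Matrix ι (Fin n) ℝ) : Submodule ℝ (EuclideanSpace ℝ (Fin n)) :=
  ⨅ k : Fin n, LinearMap.ker (Matrix.toEuclideanLin (C * A ^ (k : ℕ)))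

/-- The pair `(C, A)` is observable. -/
def Observable {n : ℕ} {ι : Type*} [Fintype ι] (A : Matrix (Fin n) (Fin n) ℝ)
    (C : Matrix ι (Fin n) ℝ) : Prop :=
  unobservableSpace A C = ⊥

/-- The matrix obtained by stacking the output matrices `C 0, …, C (m-1)`. -/
def stackedOutput {m n : ℕ} {s : Fin m → ℕ} (C : ∀ i, Matrix (Fin (s i)) (Fin n) ℝ) :
    Matrix (Σ i, Fin (s i)) (Fin n) ℝ :=
  Matrix.of fun p b => C p.1 p.2 b

/-- `Q` has full row rank and its kernel is the unobservable space of `(C, A)`. -/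
structure IsQuotientMatrix {n r s : ℕ} (A : Matrix (Fin n) (Fin n) ℝ)
    (C : Matrix (Fin s) (Fin n) ℝ) (Q : Matrix (Fin r) (Fin n) ℝ) : Prop where
  fullRowRank : LinearIndependent ℝ Q.row
  ker_eq : LinearMap.ker (Matrix.toEuclideanLin Q) = unobservableSpace A C

/-- The sequence of matrices `F` converges to zero as fast as `lam ^ τ` does. -/
def ConvergesAsFastAs {ι : Type*} [Fintype ι] [DecidableEq ι] (F : ℕ → Matrix ι ι ℝ)
    (lam : ℝ) : Prop :=
  F =O[atTop] fun τ : ℕ => lam ^ τ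

/-- `Kbar` is a gain for the quotient pair `(Cbar, Abar)` of `(C, A)` with respect to `Q`, for
which the powers of `Abar + Kbar * Cbar` converge to zero as fast as `lam ^ τ` does. -/
def IsQuotientGain {n r s : ℕ} (A : Matrix (Fin n) (Fin n) ℝ) (C : Matrix (Fin s) (Fin n) ℝ)
    (Q : Matrix (Fin r) (Fin n) ℝ) (lam : ℝ) (Kbar : Matrix (Fin r) (Fin s) ℝ) : Prop :=
  ∃ (Abar : Matrix (Fin r) (Fin r) ℝ) (Cbar : Matrix (Fin s) (Fin r) ℝ),
    Q * A = Abar * Q ∧ Cbar * Q = C ∧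
      ConvergesAsFastAs (fun τ => (Abar + Kbar * Cbar) ^ τ) lam

/-- A neighbor graph: `G.Adj j i` means that agent `j` is a neighbor of agent `i`. Every agent is
a neighbor of itself, and the graph is strongly connected. -/
structure IsNeighborGraph {m : ℕ} (G : Digraph (Fin m)) : Prop where
  self_neighbor : ∀ i, G.Adj i i
  stronglyConnected : ∀ i j, Relation.ReflTransGen G.Adj i j

open Classical in
/-- The adjacency matrix of a directed graph. -/
def adjacency {m : ℕ} (G : Digraph (Fin m)) : Matrix (Fin m) (Fin m) ℝ :=
  Matrix.of fun j i => if G.Adj j i then 1 else 0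

/-- The in-degree of vertex `i`. -/
def inDegree {m : ℕ} (G : Digraph (Fin m)) (i : Fin m) : ℕ :=
  Nat.card {j // G.Adj j i}

/-- The averaging matrix `S = D⁻¹ Adjᵀ`, with `D` the diagonal matrix of in-degrees. -/
def averaging {m : ℕ} (G : Digraph (Fin m)) : Matrix (Fin m) (Fin m) ℝ :=
  Matrix.diagonal (fun i => ((inDegree G i : ℝ))⁻¹) * (adjacency G)ᵀ

/-- `S ⊗ I_n`. -/
def averagingBar {m : ℕ} (n : ℕ) (G : Digraph (Fin m)) :
    Matrix (Fin m × Fin n) (Fin m × Fin n) ℝ :=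
  averaging G ⊗ₖ (1 : Matrix (Fin n) (Fin n) ℝ)

/-- The block diagonal matrix with the `n × n` diagonal blocks `M i`. -/
def blockDiagonalMatrix {m n : ℕ} (M : Fin m → Matrix (Fin n) (Fin n) ℝ) :
    Matrix (Fin m × Fin n) (Fin m × Fin n) ℝ :=
  Matrix.comp (Fin m) (Fin m) (Fin n) (Fin n) ℝ (Matrix.diagonal M)

/-- The matrix of the orthogonal projection on a subspace of `ℝⁿ`. -/
def projectionMatrix {n : ℕ} (U : Submodule ℝ (EuclideanSpace ℝ (Fin n))) :
    Matrix (Fin n) (Fin n) ℝ :=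
  (Matrix.toEuclideanCLM (n := Fin n) (𝕜 := ℝ)).symm U.starProjection

section Network

variable {m n : ℕ} {s : Fin m → ℕ} (A : Matrix (Fin n) (Fin n) ℝ)
  (C : ∀ i, Matrix (Fin (s i)) (Fin n) ℝ)

/-- `P = block diagonal {P_i}`, with `P_i` the orthogonal projection on the unobservable space of
`(C_i, A)`. -/
def projectionBar : Matrix (Fin m × Fin n) (Fin m × Fin n) ℝ :=
  blockDiagonalMatrix fun i => projectionMatrix (unobservableSpace A (C i))

/-- `block diagonal {A + K_i C_i}`. -/
def closedLoop (K : ∀ i, Matrix (Fin n) (Fin (s i)) ℝ) :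
    Matrix (Fin m × Fin n) (Fin m × Fin n) ℝ :=
  blockDiagonalMatrix fun i => A + K i * C i

/-- The matrix of one step of the error dynamics with `q` averaging steps. -/
def errorStep (K : ∀ i, Matrix (Fin n) (Fin (s i)) ℝ) (q : ℕ) (G : Digraph (Fin m)) :
    Matrix (Fin m × Fin n) (Fin m × Fin n) ℝ :=
  closedLoop A C K * (1 - projectionBar A C * (1 - averagingBar n G)) ^ q

/-- The error transition matrix `Φ(τ) = E(τ) ⋯ E(2) E(1)`, with `E(s)` the one-step matrix of the
graph `G s`. -/
def transition (K : ∀ i, Matrix (Fin n) (Fin (s i)) ℝ) (q : ℕ) (G : ℕ → Digraph (Fin m)) :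
    ℕ → Matrix (Fin m × Fin n) (Fin m × Fin n) ℝ
  | 0 => 1
  | τ + 1 => errorStep A C K q (G (τ + 1)) * transition K q G τ

end Network

section Restricted

variable {m n : ℕ} {s d : Fin m → ℕ} {U : Fin m → Submodule ℝ (EuclideanSpace ℝ (Fin n))}

/-- The matrix whose columns are the vectors of an orthonormal basis of a subspace of `ℝⁿ`. -/
def basisMatrix {n d : ℕ} {U : Submodule ℝ (EuclideanSpace ℝ (Fin n))}
    (b : OrthonormalBasis (Fin d) ℝ U) : Matrix (Fin n) (Fin d) ℝ :=
  Matrix.of fun a k => (b k : EuclideanSpace ℝ (Fin n)) a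

/-- `V = block diagonal {V_i}`. -/
def basisBar (b : ∀ i, OrthonormalBasis (Fin (d i)) ℝ (U i)) :
    Matrix (Fin m × Fin n) (Σ i, Fin (d i)) ℝ :=
  Matrix.of fun p k => if p.1 = k.1 then basisMatrix (b k.1) p.2 k.2 else 0

/-- `B = Vᵀ (S ⊗ I_n) V`. -/
def restrictedAveraging (b : ∀ i, OrthonormalBasis (Fin (d i)) ℝ (U i)) (G : Digraph (Fin m)) :
    Matrix (Σ i, Fin (d i)) (Σ i, Fin (d i)) ℝ :=
  (basisBar b)ᵀ * averagingBar n G * basisBar b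

/-- The matrix `A_i = V_iᵀ (A + K_i C_i) V_i` of the restriction of `A + K_i C_i`. -/
def restrictedBlock (A : Matrix (Fin n) (Fin n) ℝ) (C : ∀ i, Matrix (Fin (s i)) (Fin n) ℝ)
    (K : ∀ i, Matrix (Fin n) (Fin (s i)) ℝ) (b : ∀ i, OrthonormalBasis (Fin (d i)) ℝ (U i))
    (i : Fin m) : Matrix (Fin (d i)) (Fin (d i)) ℝ :=
  (basisMatrix (b i))ᵀ * (A + K i * C i) * basisMatrix (b i)

/-- `Ã = block diagonal {A_i}`. -/
def restrictedLoop (A : Matrix (Fin n) (Fin n) ℝ) (C : ∀ i, Matrix (Fin (s i)) (Fin n) ℝ)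
    (K : ∀ i, Matrix (Fin n) (Fin (s i)) ℝ) (b : ∀ i, OrthonormalBasis (Fin (d i)) ℝ (U i)) :
    Matrix (Σ i, Fin (d i)) (Σ i, Fin (d i)) ℝ :=
  Matrix.blockDiagonal' (restrictedBlock A C K b)

/-- The positive probability vector `π` with `Sᵀ π = π`. -/
structure IsPerronVector (G : Digraph (Fin m)) (π : Fin m → ℝ) : Prop where
  pos : ∀ i, 0 < π i
  sum_eq_one : ∑ i, π i = 1
  fixed : (averaging G)ᵀ *ᵥ π = π

/-- `R = Vᵀ (diagonal π ⊗ I_n) V`. -/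
def weight (b : ∀ i, OrthonormalBasis (Fin (d i)) ℝ (U i)) (π : Fin m → ℝ) :
    Matrix (Σ i, Fin (d i)) (Σ i, Fin (d i)) ℝ :=
  (basisBar b)ᵀ * (Matrix.diagonal π ⊗ₖ (1 : Matrix (Fin n) (Fin n) ℝ)) * basisBar b

/-- The matrix norm induced by the vector norm `x ↦ √(xᵀ R x)`, for `R` positive definite. -/
def weightedNorm {ι : Type*} [Fintype ι] (R M : Matrix ι ι ℝ) : ℝ :=
  sInf {c : ℝ | 0 ≤ c ∧ ∀ x : ι → ℝ,
    √((M *ᵥ x) ⬝ᵥ (R *ᵥ (M *ᵥ x))) ≤ c * √(x ⬝ᵥ (R *ᵥ x))}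

/-- The mixed matrix norm: the induced infinity norm (largest absolute row sum) of the `m × m`
matrix of the spectral norms of the blocks `M_ij`. -/
def mixedNorm (M : Matrix (Σ i, Fin (d i)) (Σ i, Fin (d i)) ℝ) : ℝ :=
  ⨆ i : Fin m, ∑ j : Fin m,
    ‖(Matrix.of fun a c => M ⟨i, a⟩ ⟨j, c⟩ : Matrix (Fin (d i)) (Fin (d j)) ℝ)‖

end Restricted

end DistributedObserver

end

/-!
The error dynamics of the distributed observer is block triangular. Let `P` be the block diagonal
projection on the unobservable spaces `U i` of the pairs `(C i, A)`, and let `V` be the isometry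
with `V * Vᵀ = P`. Since the averaging steps move each local error only within `U i`, they do not
affect `(1 - P) e`, and `1 - P` factors through the quotient maps `Q i`; so this component follows
the local observers of the quotient pairs and decays like `lam ^ τ`
(`complement_mul_transition`, `exists_norm_complement_mul_closedLoop_pow_le`). The component `Vᵀ e`
is multiplied in each step by `Ã * B ^ q` and perturbed by a bounded multiple of `(1 - P) e`. If
these factors are smaller than `μ` in some submultiplicative norm, then, since there are only
finitely many graphs, they are uniformly smaller than `μ`, and the perturbed recursion is
`O(μ ^ τ)` (`exists_norm_le_of_recursion`, `convergesAsFastAs_transition`).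

It remains to see that `B = Vᵀ (S ⊗ 1) V` is a contraction. In the norm weighted by the Perron
vector this follows from convexity of the square: equality would force all agents to agree on a
vector of `⨅ i, U i`, which is trivial by joint observability
(`weightedNorm_restrictedAveraging_lt_one`). The weighted norm is the spectral norm after a
diagonal rescaling (`weightedNorm_diagonal`). For the mixed norm, the blocks of `B ^ p` are
averages, over the walks of length `p`, of products of the projections met along the walk. Such a
product has norm at most one, and less than one if the walk visits all vertices; from every vertex
there is such a walk as soon as `p ≥ (m - 1) ^ 2` (`exists_coveringWalk_univ`,
`exists_block_restrictedAveraging_pow_eq`, `mixedNorm_restrictedAveraging_pow_lt_one`).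

Gains for the quotient pairs exist because an observable pair admits a deadbeat gain, which makes
the closed loop nilpotent (`exists_deadbeat_gain`). It is built along the decreasing chain of
subspaces of states that can be reached without producing any output.
-/

noncomputable section

namespace DistributedObserver

/-! ### Unobservable spaces and quotient pairs -/

theorem mem_unobservableSpace {n : ℕ} {ι : Type*} [Fintype ι] {A : Matrix (Fin n) (Fin n) ℝ}
    {C : Matrix ι (Fin n) ℝ} {x : EuclideanSpace ℝ (Fin n)} :
    x ∈ unobservableSpace A C ↔ ∀ k < n, (C * A ^ k) *ᵥ x.ofLp = 0 := by
  simp only [unobservableSpace, Submodule.mem_iInf, LinearMap.mem_ker, toLpLin_apply,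
    WithLp.toLp_eq_zero]
  exact ⟨fun h k hk => h ⟨k, hk⟩, fun h k => h k k.2⟩

/-- By the Cayley–Hamilton theorem, an initial state that is invisible for as many steps as the
dimension of the state space is invisible forever. -/
theorem output_eq_zero_of_forall_lt {n : ℕ} {ι : Type*} [Fintype ι] {A : Matrix (Fin n) (Fin n) ℝ}
    {C : Matrix ι (Fin n) ℝ} {x : Fin n → ℝ} (h : ∀ k < n, (C * A ^ k) *ᵥ x = 0) (k : ℕ) :
    (C * A ^ k) *ᵥ x = 0 := by
  rcases Nat.eq_zero_or_pos n with rfl | hn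
  · rw [Subsingleton.elim x 0, mulVec_zero]
  have hdeg : (Polynomial.X ^ k %ₘ A.charpoly).natDegree < n := by
    refine (Polynomial.natDegree_modByMonic_lt _ A.charpoly_monic ?_).trans_le ?_
    · intro h1
      have := A.charpoly_natDegree_eq_dim
      simp [h1] at this
      omega
    · simp [A.charpoly_natDegree_eq_dim]
  rw [pow_eq_aeval_mod_charpoly, Polynomial.aeval_eq_sum_range' hdeg, Matrix.mul_sum, sum_mulVec]
  refine Finset.sum_eq_zero fun j hj => ?_
  rw [Matrix.mul_smul, smul_mulVec, h j (Finset.mem_range.1 hj), smul_zero]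

section Quotient

variable {n r s : ℕ} {A : Matrix (Fin n) (Fin n) ℝ} {C : Matrix (Fin s) (Fin n) ℝ}
  {Q : Matrix (Fin r) (Fin n) ℝ} {Qinv : Matrix (Fin n) (Fin r) ℝ}

theorem output_eq_zero_of_mem {x : Fin n → ℝ}
    (hx : WithLp.toLp 2 x ∈ unobservableSpace A C) : C *ᵥ x = 0 := by
  simpa using output_eq_zero_of_forall_lt (mem_unobservableSpace.1 hx) 0

theorem mulVec_mem_unobservableSpace {x : Fin n → ℝ}
    (hx : WithLp.toLp 2 x ∈ unobservableSpace A C) :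
    WithLp.toLp 2 (A *ᵥ x) ∈ unobservableSpace A C := by
  rw [mem_unobservableSpace]
  intro k _
  have := output_eq_zero_of_forall_lt (mem_unobservableSpace.1 hx) (k + 1)
  rwa [pow_succ, ← Matrix.mul_assoc, ← mulVec_mulVec] at this

theorem IsQuotientMatrix.mulVec_eq_zero_iff (hQ : IsQuotientMatrix A C Q) {x : Fin n → ℝ} :
    Q *ᵥ x = 0 ↔ WithLp.toLp 2 x ∈ unobservableSpace A C := by
  rw [← hQ.ker_eq, LinearMap.mem_ker, toLpLin_apply, WithLp.toLp_eq_zero]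

/-- `1 - Q⁻¹ Q` maps into the unobservable space. -/
theorem IsQuotientMatrix.sub_mulVec_mem (hQ : IsQuotientMatrix A C Q) (hinv : Q * Qinv = 1)
    (x : Fin n → ℝ) : WithLp.toLp 2 ((1 - Qinv * Q) *ᵥ x) ∈ unobservableSpace A C := by
  rw [← hQ.mulVec_eq_zero_iff, mulVec_mulVec, Matrix.mul_sub, ← Matrix.mul_assoc, hinv]
  simp

/-- A matrix that vanishes on the unobservable space factors through `Q`. -/
theorem IsQuotientMatrix.eq_mul_of_forall_mem (hQ : IsQuotientMatrix A C Q) (hinv : Q * Qinv = 1)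
    {ι : Type*} [Fintype ι] {M : Matrix ι (Fin n) ℝ}
    (hM : ∀ x, WithLp.toLp 2 x ∈ unobservableSpace A C → M *ᵥ x = 0) : M = M * Qinv * Q := by
  have : M * (1 - Qinv * Q) = 0 := by
    refine Matrix.ext_of_mulVec_single fun i => ?_
    rw [← mulVec_mulVec, hM _ (hQ.sub_mulVec_mem hinv _), zero_mulVec]
  rw [Matrix.mul_sub, Matrix.mul_one, sub_eq_zero, ← Matrix.mul_assoc] at this
  exact this

theorem IsQuotientMatrix.existsUnique_state (hQ : IsQuotientMatrix A C Q) (hinv : Q * Qinv = 1) :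
    ∃! Abar : Matrix (Fin r) (Fin r) ℝ, Q * A = Abar * Q := by
  refine ⟨Q * A * Qinv, hQ.eq_mul_of_forall_mem hinv fun x hx => ?_, fun Abar h => ?_⟩
  · rw [← mulVec_mulVec]
    exact hQ.mulVec_eq_zero_iff.2 (mulVec_mem_unobservableSpace hx)
  · rw [h, Matrix.mul_assoc, hinv, Matrix.mul_one]

theorem IsQuotientMatrix.existsUnique_output (hQ : IsQuotientMatrix A C Q) (hinv : Q * Qinv = 1) :
    ∃! Cbar : Matrix (Fin s) (Fin r) ℝ, Cbar * Q = C := by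
  refine ⟨C * Qinv, (hQ.eq_mul_of_forall_mem hinv fun x hx => output_eq_zero_of_mem hx).symm,
    fun Cbar h => ?_⟩
  rw [← h, Matrix.mul_assoc, hinv, Matrix.mul_one]

theorem mul_pow_eq_pow_mul {Abar : Matrix (Fin r) (Fin r) ℝ} (hA : Q * A = Abar * Q) (k : ℕ) :
    Q * A ^ k = Abar ^ k * Q := by
  induction k with
  | zero => simp
  | succ k ih => rw [pow_succ, ← Matrix.mul_assoc, ih, Matrix.mul_assoc, hA, pow_succ,
      Matrix.mul_assoc]

theorem IsQuotientMatrix.observable (hQ : IsQuotientMatrix A C Q) (hinv : Q * Qinv = 1)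
    {Abar : Matrix (Fin r) (Fin r) ℝ} {Cbar : Matrix (Fin s) (Fin r) ℝ}
    (hA : Q * A = Abar * Q) (hC : Cbar * Q = C) : Observable Abar Cbar := by
  rw [Observable, Submodule.eq_bot_iff]
  intro z hz
  have hmem : WithLp.toLp 2 (Qinv *ᵥ z.ofLp) ∈ unobservableSpace A C := by
    rw [mem_unobservableSpace]
    intro k _
    rw [← hC, Matrix.mul_assoc, mul_pow_eq_pow_mul hA, ← Matrix.mul_assoc, mulVec_mulVec,
      Matrix.mul_assoc, hinv, Matrix.mul_one]
    exact output_eq_zero_of_forall_lt (mem_unobservableSpace.1 hz) k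
  rw [← hQ.mulVec_eq_zero_iff, mulVec_mulVec, hinv, one_mulVec] at hmem
  exact (WithLp.ofLp_eq_zero 2).1 hmem

end Quotient

/-! ### Deadbeat output injection -/

section Deadbeat

variable {E F : Type*} [AddCommGroup E] [Module ℝ E] [AddCommGroup F] [Module ℝ F]

/-- The states that can be reached after `k` steps of `x ↦ f x` with zero output `g` in all `k`
steps. -/
def silentlyReachable (f : E →ₗ[ℝ] E) (g : E →ₗ[ℝ] F) (k : ℕ) : Submodule ℝ E :=
  (⨅ j : Fin k, LinearMap.ker (g ∘ₗ f ^ (j : ℕ))).map (f ^ k)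

theorem mem_silentlyReachable {f : E →ₗ[ℝ] E} {g : E →ₗ[ℝ] F} {k : ℕ} {x : E} :
    x ∈ silentlyReachable f g k ↔ ∃ y, (∀ j < k, g ((f ^ j) y) = 0) ∧ (f ^ k) y = x := by
  simp only [silentlyReachable, Submodule.mem_map, Submodule.mem_iInf, LinearMap.mem_ker,
    LinearMap.comp_apply]
  exact exists_congr fun y => and_congr_left' ⟨fun h j hj => h ⟨j, hj⟩, fun h j => h j j.2⟩

theorem silentlyReachable_succ_le (f : E →ₗ[ℝ] E) (g : E →ₗ[ℝ] F) (k : ℕ) :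
    silentlyReachable f g (k + 1) ≤ silentlyReachable f g k := by
  intro x hx
  obtain ⟨y, hy, rfl⟩ := mem_silentlyReachable.1 hx
  refine mem_silentlyReachable.2 ⟨f y, fun j hj => ?_, ?_⟩
  · rw [← Module.End.mul_apply, ← pow_succ]
    exact hy _ (by omega)
  · rw [← Module.End.mul_apply, ← pow_succ]

theorem apply_mem_silentlyReachable_succ {f : E →ₗ[ℝ] E} {g : E →ₗ[ℝ] F} {k : ℕ} {x : E}
    (hx : x ∈ silentlyReachable f g k) (hg : g x = 0) : f x ∈ silentlyReachable f g (k + 1) := by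
  obtain ⟨y, hy, rfl⟩ := mem_silentlyReachable.1 hx
  refine mem_silentlyReachable.2 ⟨y, fun j hj => ?_, ?_⟩
  · rcases Nat.lt_succ_iff_lt_or_eq.1 hj with h | rfl
    exacts [hy j h, hg]
  · rw [pow_succ', Module.End.mul_apply]

/-- One step in the construction of a deadbeat gain: a gain that pushes every later term of the
decreasing chain `silentlyReachable f g` into its successor can be altered so that it does so for
the `k`-th term as well. -/
theorem exists_gain_extension (f : E →ₗ[ℝ] E) (g : E →ₗ[ℝ] F) (k : ℕ) (K : F →ₗ[ℝ] E)
    (hK : ∀ j ≥ k + 1, ∀ x ∈ silentlyReachable f g j,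
      f x + K (g x) ∈ silentlyReachable f g (j + 1)) :
    ∃ K' : F →ₗ[ℝ] E, ∀ j ≥ k, ∀ x ∈ silentlyReachable f g j,
      f x + K' (g x) ∈ silentlyReachable f g (j + 1) := by
  set T := silentlyReachable f g with hT
  have hanti : Antitone T := antitone_nat_of_succ_le (silentlyReachable_succ_le f g)
  -- a projection on `g (T (k+1))` and a linear section of `g` on `T k`
  obtain ⟨p, hp⟩ := ((T (k + 1)).map g).subtype.exists_leftInverse_of_injective
    (Submodule.ker_subtype _)
  have hp' : ∀ y (hy : y ∈ (T (k + 1)).map g), (p y : F) = y := fun y hy => by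
    have := LinearMap.congr_fun hp ⟨y, hy⟩
    simpa using congrArg Subtype.val this
  obtain ⟨σ, hσ⟩ := (g.domRestrict (T k)).rangeRestrict.exists_rightInverse_of_surjective
    (LinearMap.range_rangeRestrict _)
  obtain ⟨e, he⟩ := (LinearMap.range (g.domRestrict (T k))).subtype.exists_leftInverse_of_injective
    (Submodule.ker_subtype _)
  have hσ' : ∀ x ∈ T k, g (σ (e (g x)) : E) = g x := fun x hx => by
    have h1 := LinearMap.congr_fun he ⟨g x, ⟨⟨x, hx⟩, rfl⟩⟩
    have h2 := LinearMap.congr_fun hσ (e (g x))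
    have h3 := congrArg Subtype.val h2
    have h4 := congrArg Subtype.val h1
    simp at h3 h4 h1
    rw [h3, h1]
  -- `L` cancels `f` on the chosen representatives; it acts on the part of the output outside
  -- `g (T (k+1))`, on which `K` is kept
  let L : F →ₗ[ℝ] E := -(f ∘ₗ (T k).subtype ∘ₗ σ ∘ₗ e)
  let P : F →ₗ[ℝ] F := Submodule.subtype _ ∘ₗ p
  refine ⟨K ∘ₗ P + L ∘ₗ (LinearMap.id - P), fun j hj x hx => ?_⟩
  rcases Nat.eq_or_lt_of_le hj with rfl | hlt
  · obtain ⟨x₁, hx₁, hgx₁⟩ := (p (g x)).2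
    have hx₁' : x₁ ∈ T k := hanti (Nat.le_succ k) hx₁
    have hgx₁' : P (g x) = g x₁ := hgx₁.symm
    have hw : x - x₁ - (σ (e (g (x - x₁))) : E) ∈ T k :=
      sub_mem (sub_mem hx hx₁') (σ _).2
    have hgw : g (x - x₁ - (σ (e (g (x - x₁))) : E)) = 0 := by
      rw [map_sub, hσ' _ (sub_mem hx hx₁'), sub_self]
    have h1 : f x₁ + K (g x₁) ∈ T (k + 1) := hanti (Nat.le_succ _) (hK _ le_rfl _ hx₁)
    convert add_mem h1 (apply_mem_silentlyReachable_succ hw hgw) using 1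
    simp only [LinearMap.add_apply, LinearMap.comp_apply, LinearMap.sub_apply, hgx₁', L,
      LinearMap.neg_apply, LinearMap.id_apply, Submodule.subtype_apply, map_sub,
      Submodule.coe_sub]
    abel
  · have hPx : P (g x) = g x := hp' _ ⟨x, hanti hlt hx, rfl⟩
    simpa [hPx] using hK j hlt x hx

/-- An observable pair has a gain that makes the closed loop nilpotent. Observability in `N` steps
means that the chain `silentlyReachable f g` ends in `⊥` at `N`, and a gain can be chosen, from the
end of the chain backwards, that moves the state down the whole chain. -/
theorem exists_deadbeat_gain (f : E →ₗ[ℝ] E) (g : E →ₗ[ℝ] F) (N : ℕ)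
    (hobs : ∀ x, (∀ j < N, g ((f ^ j) x) = 0) → x = 0) :
    ∃ K : F →ₗ[ℝ] E, (f + K ∘ₗ g) ^ N = 0 := by
  have hN : silentlyReachable f g N = ⊥ := by
    rw [Submodule.eq_bot_iff]
    intro x hx
    obtain ⟨y, hy, rfl⟩ := mem_silentlyReachable.1 hx
    rw [hobs y hy, map_zero]
  have key : ∀ i ≤ N, ∃ K : F →ₗ[ℝ] E, ∀ j ≥ N - i, ∀ x ∈ silentlyReachable f g j,
      f x + K (g x) ∈ silentlyReachable f g (j + 1) := by
    intro i
    induction i with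
    | zero =>
      refine fun _ => ⟨0, fun j hj x hx => ?_⟩
      have h1 : x ∈ silentlyReachable f g N :=
        antitone_nat_of_succ_le (silentlyReachable_succ_le f g) hj hx
      rw [hN, Submodule.mem_bot] at h1
      simp [h1]
    | succ i ih =>
      intro hi
      obtain ⟨K, hK⟩ := ih (by omega)
      refine exists_gain_extension f g (N - (i + 1)) K fun j hj => hK j (by omega)
  obtain ⟨K, hK⟩ := key N le_rfl
  refine ⟨K, LinearMap.ext fun x => ?_⟩
  have hmem : ∀ k, ((f + K ∘ₗ g) ^ k) x ∈ silentlyReachable f g k := by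
    intro k
    induction k with
    | zero => exact mem_silentlyReachable.2 ⟨x, by simp, by simp⟩
    | succ k ih =>
      rw [pow_succ', Module.End.mul_apply]
      exact hK k (by omega) _ ih
  simpa [hN] using hmem N

end Deadbeat

theorem Observable.exists_gain {n s : ℕ} {A : Matrix (Fin n) (Fin n) ℝ}
    {C : Matrix (Fin s) (Fin n) ℝ} (h : Observable A C) :
    ∃ K : Matrix (Fin n) (Fin s) ℝ, (A + K * C) ^ n = 0 := by
  obtain ⟨K, hK⟩ := exists_deadbeat_gain (toLin' A) (toLin' C) n fun x hx => by
    have : WithLp.toLp 2 x ∈ unobservableSpace A C := by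
      refine mem_unobservableSpace.2 fun k hk => ?_
      have := hx k hk
      rwa [← toLin'_pow, ← LinearMap.comp_apply, ← toLin'_mul, toLin'_apply] at this
    rw [h, Submodule.mem_bot] at this
    exact (WithLp.toLp_eq_zero 2).1 this
  refine ⟨LinearMap.toMatrix' K, toLin'.injective ?_⟩
  rw [toLin'_pow, map_add, toLin'_mul, toLin'_toMatrix', hK, map_zero]

theorem Observable.exists_convergesAsFastAs {n s : ℕ} {A : Matrix (Fin n) (Fin n) ℝ}
    {C : Matrix (Fin s) (Fin n) ℝ} (h : Observable A C) (lam : ℝ) :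
    ∃ K : Matrix (Fin n) (Fin s) ℝ, ConvergesAsFastAs (fun τ => (A + K * C) ^ τ) lam := by
  obtain ⟨K, hK⟩ := h.exists_gain
  refine ⟨K, IsBigO.of_bound 0 ?_⟩
  filter_upwards [eventually_ge_atTop n] with τ hτ
  rw [← Nat.sub_add_cancel hτ, pow_add, hK, mul_zero]
  simp

/-! ### Spectral norms -/

section SpectralNorm

variable {ι κ : Type*} [Fintype ι] [Fintype κ]

theorem norm_toLp_sq (x : ι → ℝ) : ‖WithLp.toLp 2 x‖ ^ 2 = x ⬝ᵥ x := by
  rw [EuclideanSpace.real_norm_sq_eq, dotProduct]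
  exact Finset.sum_congr rfl fun i _ => sq _

theorem norm_toLp_eq_sqrt (x : ι → ℝ) : ‖WithLp.toLp 2 x‖ = √(x ⬝ᵥ x) := by
  rw [← norm_toLp_sq, Real.sqrt_sq (norm_nonneg _)]

variable [DecidableEq κ]

theorem norm_toLp_mulVec_le (M : Matrix ι κ ℝ) (x : κ → ℝ) :
    ‖WithLp.toLp 2 (M *ᵥ x)‖ ≤ ‖M‖ * ‖WithLp.toLp 2 x‖ :=
  l2_opNorm_mulVec M (WithLp.toLp 2 x)

theorem l2_opNorm_le {M : Matrix ι κ ℝ} {c : ℝ} (hc : 0 ≤ c)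
    (h : ∀ x, ‖WithLp.toLp 2 (M *ᵥ x)‖ ≤ c * ‖WithLp.toLp 2 x‖) : ‖M‖ ≤ c := by
  rw [l2_opNorm_def]
  exact ContinuousLinearMap.opNorm_le_bound _ hc fun x => h x.ofLp

theorem l2_opNorm_le_one {M : Matrix ι κ ℝ} (h : ∀ x, (M *ᵥ x) ⬝ᵥ (M *ᵥ x) ≤ x ⬝ᵥ x) :
    ‖M‖ ≤ 1 :=
  l2_opNorm_le zero_le_one fun x => by
    rw [one_mul, norm_toLp_eq_sqrt, norm_toLp_eq_sqrt]
    exact Real.sqrt_le_sqrt (h x)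

/-- By compactness of the unit sphere, a matrix that shortens every nonzero vector has spectral norm
less than one. -/
theorem l2_opNorm_lt_one {M : Matrix ι κ ℝ}
    (h : ∀ x, x ≠ 0 → (M *ᵥ x) ⬝ᵥ (M *ᵥ x) < x ⬝ᵥ x) : ‖M‖ < 1 := by
  have hlt : ∀ x : EuclideanSpace ℝ κ, x ≠ 0 → ‖WithLp.toLp 2 (M *ᵥ x.ofLp)‖ < ‖x‖ := by
    intro x hx
    have := h x.ofLp fun h0 => hx ((WithLp.ofLp_eq_zero 2).1 h0)
    rw [← norm_toLp_sq, ← norm_toLp_sq] at this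
    exact lt_of_pow_lt_pow_left₀ 2 (norm_nonneg _) this
  rcases (Metric.sphere (0 : EuclideanSpace ℝ κ) 1).eq_empty_or_nonempty with he | hne
  · refine (l2_opNorm_le (M := M) le_rfl fun x => ?_).trans_lt one_pos
    have : Subsingleton (EuclideanSpace ℝ κ) := by
      by_contra hns
      rw [not_subsingleton_iff_nontrivial] at hns
      obtain ⟨y, hy⟩ := exists_norm_eq (EuclideanSpace ℝ κ) zero_le_one
      have : y ∈ Metric.sphere (0 : EuclideanSpace ℝ κ) 1 := by simpa using hy
      rw [he] at this
      exact this
    have hx : x = 0 := congrArg WithLp.ofLp (Subsingleton.elim (WithLp.toLp 2 x) 0)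
    simp [hx]
  · have hcont : Continuous fun x : EuclideanSpace ℝ κ => ‖WithLp.toLp 2 (M *ᵥ x.ofLp)‖ :=
      ((toEuclideanLin M).continuous_of_finiteDimensional).norm
    obtain ⟨x₀, hx₀, hmax⟩ :=
      (isCompact_sphere (0 : EuclideanSpace ℝ κ) 1).exists_isMaxOn hne hcont.continuousOn
    have hx₀' : ‖x₀‖ = 1 := by simpa using hx₀
    have hx₀0 : x₀ ≠ 0 := by
      rintro rfl
      simp at hx₀'
    refine (l2_opNorm_le (norm_nonneg (WithLp.toLp 2 (M *ᵥ x₀.ofLp))) fun x => ?_).trans_lt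
      ((hlt x₀ hx₀0).trans_eq hx₀')
    by_cases hx : WithLp.toLp 2 x = 0
    · have hx : x = 0 := congrArg WithLp.ofLp hx
      simp [hx]
    · have hn : 0 < ‖WithLp.toLp 2 x‖ := norm_pos_iff.2 hx
      have hmem : (‖WithLp.toLp 2 x‖⁻¹ • WithLp.toLp 2 x) ∈
          Metric.sphere (0 : EuclideanSpace ℝ κ) 1 := by
        simp [norm_smul, hn.ne']
      have := hmax hmem
      simp only [Set.mem_ofPred_eq, WithLp.ofLp_smul, mulVec_smul, WithLp.toLp_smul, norm_smul,
        norm_inv, norm_norm] at this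
      rwa [inv_mul_le_iff₀ hn, mul_comm] at this

theorem abs_entry_le_l2_opNorm (M : Matrix ι κ ℝ) (a : ι) (c : κ) : |M a c| ≤ ‖M‖ := by
  have h := norm_toLp_mulVec_le M (Pi.single c 1)
  have h1 : ‖WithLp.toLp 2 (Pi.single c 1 : κ → ℝ)‖ = 1 := by simp
  rw [h1, mul_one, mulVec_single_one] at h
  exact (PiLp.norm_apply_le (WithLp.toLp 2 (M.col c)) a).trans h

/-- The spectral norm is bounded by a multiple of the largest absolute value of an entry. -/
theorem exists_l2_opNorm_le_of_abs_entry_le [DecidableEq ι] :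
    ∃ c : ℝ, 0 ≤ c ∧ ∀ (M : Matrix ι κ ℝ) (t : ℝ), (∀ a b, |M a b| ≤ t) → ‖M‖ ≤ c * t := by
  refine ⟨∑ a : ι, ∑ b : κ, ‖(Matrix.single a b 1 : Matrix ι κ ℝ)‖, by positivity,
    fun M t h => ?_⟩
  conv_lhs => rw [matrix_eq_sum_single M]
  refine (norm_sum_le _ _).trans ?_
  rw [Finset.sum_mul]
  refine Finset.sum_le_sum fun a _ => (norm_sum_le _ _).trans ?_
  rw [Finset.sum_mul]
  refine Finset.sum_le_sum fun b _ => ?_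
  have : (Matrix.single a b (M a b) : Matrix ι κ ℝ) = M a b • Matrix.single a b 1 := by
    rw [smul_single, smul_eq_mul, mul_one]
  rw [this, norm_smul, mul_comm, Real.norm_eq_abs]
  exact mul_le_mul_of_nonneg_left (h a b) (norm_nonneg _)

end SpectralNorm

/-! ### Orthonormal bases and block diagonal matrices -/

section BasisMatrix

variable {n d : ℕ} {U : Submodule ℝ (EuclideanSpace ℝ (Fin n))}

theorem basisMatrix_transpose_mul_self (b : OrthonormalBasis (Fin d) ℝ U) :
    (basisMatrix b)ᵀ * basisMatrix b = 1 := by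
  ext k l
  have h := orthonormal_iff_ite.1 b.orthonormal l k
  rw [Submodule.coe_inner, EuclideanSpace.inner_eq_star_dotProduct] at h
  rw [Matrix.mul_apply, Matrix.one_apply, if_congr (eq_comm (a := k)) rfl rfl, ← h]
  rfl

theorem toLp_basisMatrix_mulVec (b : OrthonormalBasis (Fin d) ℝ U) (y : Fin d → ℝ) :
    WithLp.toLp 2 (basisMatrix b *ᵥ y) = ((∑ k, y k • b k : U) : EuclideanSpace ℝ (Fin n)) := by
  ext a
  simp [basisMatrix, mulVec, dotProduct, mul_comm]

theorem basisMatrix_mulVec_mem (b : OrthonormalBasis (Fin d) ℝ U) (y : Fin d → ℝ) :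
    WithLp.toLp 2 (basisMatrix b *ᵥ y) ∈ U := by
  rw [toLp_basisMatrix_mulVec]
  exact Subtype.property _

theorem projectionMatrix_mulVec (U : Submodule ℝ (EuclideanSpace ℝ (Fin n))) (x : Fin n → ℝ) :
    WithLp.toLp 2 (projectionMatrix U *ᵥ x) = U.starProjection (WithLp.toLp 2 x) := by
  rw [← toEuclideanCLM_toLp (𝕜 := ℝ), projectionMatrix]
  exact congrArg (fun f => f (WithLp.toLp 2 x))
    ((toEuclideanCLM (n := Fin n) (𝕜 := ℝ)).apply_symm_apply U.starProjection)

theorem basisMatrix_mul_transpose (b : OrthonormalBasis (Fin d) ℝ U) :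
    basisMatrix b * (basisMatrix b)ᵀ = projectionMatrix U := by
  refine Matrix.ext_of_mulVec_single fun i => ?_
  set x : Fin n → ℝ := Pi.single i 1
  apply WithLp.toLp_injective 2
  rw [projectionMatrix_mulVec, Submodule.starProjection_apply,
    b.orthogonalProjectionOnto_apply_eq_sum, ← mulVec_mulVec, toLp_basisMatrix_mulVec]
  congr 1
  refine Finset.sum_congr rfl fun k _ => ?_
  rw [EuclideanSpace.inner_eq_star_dotProduct, dotProduct_comm]
  rfl

theorem projectionMatrix_mulVec_eq_self {x : Fin n → ℝ} (hx : WithLp.toLp 2 x ∈ U) :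
    projectionMatrix U *ᵥ x = x := by
  apply WithLp.toLp_injective 2
  rw [projectionMatrix_mulVec, Submodule.starProjection_eq_self_iff.2 hx]

theorem projectionMatrix_mulVec_mem (x : Fin n → ℝ) :
    WithLp.toLp 2 (projectionMatrix U *ᵥ x) ∈ U := by
  rw [projectionMatrix_mulVec]
  exact Submodule.starProjection_apply_mem U _

theorem dotProduct_basisMatrix_mulVec_self (b : OrthonormalBasis (Fin d) ℝ U) (y : Fin d → ℝ) :
    (basisMatrix b *ᵥ y) ⬝ᵥ (basisMatrix b *ᵥ y) = y ⬝ᵥ y := by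
  rw [dotProduct_mulVec, ← mulVec_transpose, mulVec_mulVec, basisMatrix_transpose_mul_self,
    one_mulVec]

/-- Pythagoras for the orthogonal projection on `U`, in coordinates. -/
theorem dotProduct_basisMatrix_transpose_mulVec_self (b : OrthonormalBasis (Fin d) ℝ U)
    (x : Fin n → ℝ) :
    x ⬝ᵥ x = ((basisMatrix b)ᵀ *ᵥ x) ⬝ᵥ ((basisMatrix b)ᵀ *ᵥ x) +
      (x - projectionMatrix U *ᵥ x) ⬝ᵥ (x - projectionMatrix U *ᵥ x) := by
  have h1 : ((basisMatrix b)ᵀ *ᵥ x) ⬝ᵥ ((basisMatrix b)ᵀ *ᵥ x) =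
      x ⬝ᵥ (projectionMatrix U *ᵥ x) := by
    rw [← basisMatrix_mul_transpose b, ← mulVec_mulVec, dotProduct_mulVec x, ← mulVec_transpose]
  have h2 : (projectionMatrix U *ᵥ x) ⬝ᵥ (projectionMatrix U *ᵥ x) =
      x ⬝ᵥ (projectionMatrix U *ᵥ x) := by
    rw [← h1, ← basisMatrix_mul_transpose b, ← mulVec_mulVec, dotProduct_basisMatrix_mulVec_self]
  rw [h1, sub_dotProduct, dotProduct_sub, dotProduct_sub, h2,
    dotProduct_comm (projectionMatrix U *ᵥ x) x]
  ring

theorem basisMatrix_transpose_contraction (b : OrthonormalBasis (Fin d) ℝ U) (x : Fin n → ℝ) :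
    ((basisMatrix b)ᵀ *ᵥ x) ⬝ᵥ ((basisMatrix b)ᵀ *ᵥ x) ≤ x ⬝ᵥ x := by
  rw [dotProduct_basisMatrix_transpose_mulVec_self b x]
  exact le_add_of_nonneg_right (Finset.sum_nonneg fun i _ => mul_self_nonneg _)

/-- Equality in `basisMatrix_transpose_contraction` forces `x` to lie in `U`. -/
theorem projectionMatrix_mulVec_eq_self_of_le (b : OrthonormalBasis (Fin d) ℝ U) {x : Fin n → ℝ}
    (h : x ⬝ᵥ x ≤ ((basisMatrix b)ᵀ *ᵥ x) ⬝ᵥ ((basisMatrix b)ᵀ *ᵥ x)) :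
    projectionMatrix U *ᵥ x = x := by
  rw [dotProduct_basisMatrix_transpose_mulVec_self b x] at h
  have h0 : (x - projectionMatrix U *ᵥ x) ⬝ᵥ (x - projectionMatrix U *ᵥ x) = 0 :=
    le_antisymm (by linarith) (Finset.sum_nonneg fun i _ => mul_self_nonneg _)
  exact (sub_eq_zero.1 (dotProduct_self_eq_zero.1 h0)).symm

theorem norm_basisMatrix_transpose_mul_le {d' : ℕ} {U' : Submodule ℝ (EuclideanSpace ℝ (Fin n))}
    (b : OrthonormalBasis (Fin d) ℝ U) (b' : OrthonormalBasis (Fin d') ℝ U') :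
    ‖(basisMatrix b)ᵀ * basisMatrix b'‖ ≤ 1 :=
  l2_opNorm_le_one fun y => by
    rw [← mulVec_mulVec, ← dotProduct_basisMatrix_mulVec_self b' y]
    exact basisMatrix_transpose_contraction b _

end BasisMatrix

section BlockDiagonal

variable {m n : ℕ}

theorem blockDiagonalMatrix_apply (M : Fin m → Matrix (Fin n) (Fin n) ℝ) (i j : Fin m)
    (a c : Fin n) : blockDiagonalMatrix M (i, a) (j, c) = if i = j then M i a c else 0 := by
  simp only [blockDiagonalMatrix, Matrix.comp_apply, Matrix.diagonal_apply]
  split_ifs <;> rfl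

theorem blockDiagonalMatrix_mul (M N : Fin m → Matrix (Fin n) (Fin n) ℝ) :
    blockDiagonalMatrix M * blockDiagonalMatrix N = blockDiagonalMatrix fun i => M i * N i := by
  ext ⟨i, a⟩ ⟨j, c⟩
  simp only [Matrix.mul_apply, Fintype.sum_prod_type, blockDiagonalMatrix_apply, ite_mul, zero_mul,
    Finset.sum_ite_irrel, Finset.sum_const_zero, Finset.sum_ite_eq', Finset.mem_univ, if_true,
    mul_ite, mul_zero]
  by_cases h : i = j
  · subst h; rfl
  · simp only [if_neg h]

theorem blockDiagonalMatrix_one :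
    blockDiagonalMatrix (fun _ : Fin m => (1 : Matrix (Fin n) (Fin n) ℝ)) = 1 := by
  ext ⟨i, a⟩ ⟨j, c⟩
  simp only [blockDiagonalMatrix_apply, Matrix.one_apply, Prod.mk.injEq, ite_and]

theorem blockDiagonalMatrix_sub (M N : Fin m → Matrix (Fin n) (Fin n) ℝ) :
    blockDiagonalMatrix M - blockDiagonalMatrix N = blockDiagonalMatrix fun i => M i - N i := by
  ext ⟨i, a⟩ ⟨j, c⟩
  simp only [Matrix.sub_apply, blockDiagonalMatrix_apply]
  split_ifs <;> simp

theorem blockDiagonalMatrix_pow (M : Fin m → Matrix (Fin n) (Fin n) ℝ) (k : ℕ) :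
    blockDiagonalMatrix M ^ k = blockDiagonalMatrix fun i => M i ^ k := by
  induction k with
  | zero => simp [blockDiagonalMatrix_one]
  | succ k ih => simp only [pow_succ, ih, blockDiagonalMatrix_mul]

variable {d : Fin m → ℕ} {U : Fin m → Submodule ℝ (EuclideanSpace ℝ (Fin n))}
  (b : ∀ i, OrthonormalBasis (Fin (d i)) ℝ (U i))

theorem basisBar_apply (i : Fin m) (a : Fin n) (j : Fin m) (k : Fin (d j)) :
    basisBar b (i, a) ⟨j, k⟩ = if i = j then basisMatrix (b j) a k else 0 := rfl

theorem basisBar_transpose_mul_self : (basisBar b)ᵀ * basisBar b = 1 := by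
  ext ⟨i, k⟩ ⟨j, l⟩
  simp only [Matrix.mul_apply, Fintype.sum_prod_type, Matrix.transpose_apply, basisBar_apply,
    ite_mul, zero_mul, Finset.sum_ite_irrel, Finset.sum_const_zero, Finset.sum_ite_eq',
    Finset.mem_univ, if_true, mul_ite, mul_zero]
  by_cases h : i = j
  · subst h
    have := congrFun (congrFun (basisMatrix_transpose_mul_self (b i)) k) l
    simp only [Matrix.mul_apply, Matrix.transpose_apply] at this
    simp [this, Matrix.one_apply]
  · rw [if_neg (Ne.symm h), Matrix.one_apply_ne]
    simp [h]

theorem basisBar_mul_transpose :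
    basisBar b * (basisBar b)ᵀ = blockDiagonalMatrix fun i => projectionMatrix (U i) := by
  ext ⟨i, a⟩ ⟨j, c⟩
  simp only [Matrix.mul_apply, Fintype.sum_sigma, Matrix.transpose_apply, basisBar_apply,
    blockDiagonalMatrix_apply, ← basisMatrix_mul_transpose (b i), ite_mul, zero_mul,
    Finset.sum_ite_irrel, Finset.sum_const_zero, Finset.sum_ite_eq, Finset.mem_univ, if_true,
    mul_ite, mul_zero]
  by_cases h : i = j
  · subst h; simp
  · simp [h]

theorem blockDiagonalMatrix_mul_basisBar {M : Fin m → Matrix (Fin n) (Fin n) ℝ}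
    {N : ∀ i, Matrix (Fin (d i)) (Fin (d i)) ℝ}
    (h : ∀ i, M i * basisMatrix (b i) = basisMatrix (b i) * N i) :
    blockDiagonalMatrix M * basisBar b = basisBar b * Matrix.blockDiagonal' N := by
  ext ⟨i, a⟩ ⟨j, k⟩
  simp only [Matrix.mul_apply, Fintype.sum_prod_type, Fintype.sum_sigma, basisBar_apply,
    blockDiagonalMatrix_apply, ite_mul, zero_mul,
    Finset.sum_ite_irrel, Finset.sum_const_zero, Finset.sum_ite_eq', Finset.sum_ite_eq,
    Finset.mem_univ, if_true, mul_ite, mul_zero]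
  by_cases hij : i = j
  · subst hij
    have := congrFun (congrFun (h i) a) k
    simp only [Matrix.mul_apply] at this
    simpa using this
  · rw [if_neg hij]
    symm
    refine Finset.sum_eq_zero fun l _ => ?_
    rw [blockDiagonal'_apply_ne _ _ _ hij, mul_zero]

end BlockDiagonal

/-! ### The averaging matrix of a neighbor graph and its Perron vector -/

section Averaging

variable {m : ℕ} {G : Digraph (Fin m)}

theorem averaging_apply (G : Digraph (Fin m)) (i k : Fin m) :
    averaging G i k = ((inDegree G i : ℝ))⁻¹ * adjacency G k i := by
  rw [averaging, Matrix.diagonal_mul, Matrix.transpose_apply]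

theorem averaging_nonneg (G : Digraph (Fin m)) (i k : Fin m) : 0 ≤ averaging G i k := by
  classical
  rw [averaging_apply, adjacency, Matrix.of_apply]
  split_ifs <;> positivity

theorem averaging_pos {i k : Fin m} (h : G.Adj k i) : 0 < averaging G i k := by
  classical
  have : Nonempty {j // G.Adj j i} := ⟨⟨k, h⟩⟩
  rw [averaging_apply, adjacency, Matrix.of_apply, if_pos h, mul_one, inv_pos, Nat.cast_pos]
  exact Nat.card_pos

theorem IsNeighborGraph.sum_averaging (hG : IsNeighborGraph G) (i : Fin m) :
    ∑ k, averaging G i k = 1 := by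
  classical
  have hpos : (inDegree G i : ℝ) ≠ 0 := by
    have : Nonempty {j // G.Adj j i} := ⟨⟨i, hG.self_neighbor i⟩⟩
    exact Nat.cast_ne_zero.2 Nat.card_pos.ne'
  have hsum : ∑ k, adjacency G k i = inDegree G i := by
    simp only [adjacency, Matrix.of_apply, Finset.sum_boole, inDegree, Nat.card_eq_fintype_card,
      Fintype.card_subtype]
  simp only [averaging_apply]
  rw [← Finset.mul_sum, hsum, inv_mul_cancel₀ hpos]

/-- A left eigenvector `v` of the averaging matrix exists because the matrix has the right
eigenvector `1`; replacing `v` by `|v|` can only increase `Sᵀ v`, without changing the total mass,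
so `|v|` is fixed too, and strong connectivity spreads positivity to all entries. -/
theorem IsNeighborGraph.exists_isPerronVector (hG : IsNeighborGraph G) (hm : 0 < m) :
    ∃ π, IsPerronVector G π := by
  have hdet : (averaging G - 1)ᵀ.det = 0 := by
    rw [det_transpose]
    refine exists_mulVec_eq_zero_iff.1 ⟨fun _ => 1, fun h => one_ne_zero (congrFun h ⟨0, hm⟩), ?_⟩
    funext i
    rw [sub_mulVec, one_mulVec]
    simp [mulVec, dotProduct, hG.sum_averaging i]
  obtain ⟨v, hv0, hv⟩ := exists_mulVec_eq_zero_iff.2 hdet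
  have hv' : ∀ i, v i = ∑ j, averaging G j i * v j := fun i => by
    rw [transpose_sub, transpose_one, sub_mulVec, one_mulVec, sub_eq_zero] at hv
    exact (congrFun hv i).symm
  have hle : ∀ i ∈ Finset.univ, |v i| ≤ ∑ j, averaging G j i * |v j| := fun i _ => by
    conv_lhs => rw [hv' i]
    refine (Finset.abs_sum_le_sum_abs _ _).trans_eq (Finset.sum_congr rfl fun j _ => ?_)
    rw [abs_mul, abs_of_nonneg (averaging_nonneg G j i)]
  have hsum : ∑ i, |v i| = ∑ i, ∑ j, averaging G j i * |v j| := by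
    rw [Finset.sum_comm]
    refine Finset.sum_congr rfl fun j _ => ?_
    rw [← Finset.sum_mul, hG.sum_averaging, one_mul]
  have hfix : ∀ i, |v i| = ∑ j, averaging G j i * |v j| := fun i =>
    (Finset.sum_eq_sum_iff_of_le hle).1 hsum i (Finset.mem_univ i)
  obtain ⟨j₀, hj₀⟩ := Function.ne_iff.1 hv0
  have hstep : ∀ i j, G.Adj i j → 0 < |v j| → 0 < |v i| := fun i j hij hj => by
    rw [hfix i]
    refine Finset.sum_pos' (fun k _ => mul_nonneg (averaging_nonneg G k i) (abs_nonneg _))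
      ⟨j, Finset.mem_univ j, mul_pos (averaging_pos hij) hj⟩
  have hpos : ∀ i, 0 < |v i| := fun i => by
    induction hG.stronglyConnected i j₀ using Relation.ReflTransGen.head_induction_on with
    | refl => exact abs_pos.2 hj₀
    | head h _ ih => exact hstep _ _ h ih
  have hS : 0 < ∑ i, |v i| := Finset.sum_pos (fun i _ => hpos i) ⟨j₀, Finset.mem_univ _⟩
  refine ⟨fun i => |v i| / ∑ i, |v i|, fun i => div_pos (hpos i) hS, ?_, ?_⟩
  · rw [← Finset.sum_div, div_self hS.ne']
  · funext i
    rw [hfix i, Finset.sum_div]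
    simp only [mulVec, dotProduct, Matrix.transpose_apply, mul_div_assoc]

theorem IsPerronVector.sum_mul_averaging {π : Fin m → ℝ} (hπ : IsPerronVector G π) (j : Fin m) :
    ∑ i, π i * averaging G i j = π j := by
  conv_rhs => rw [← hπ.fixed]
  simp only [mulVec, dotProduct, Matrix.transpose_apply, mul_comm]

end Averaging

/-! ### Block structure of the restricted averaging matrix -/

section Block

variable {m n : ℕ} {d : Fin m → ℕ} {U : Fin m → Submodule ℝ (EuclideanSpace ℝ (Fin n))}

/-- The block in position `(i, j)` of a matrix partitioned according to `d`. -/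
def block (M : Matrix (Σ i, Fin (d i)) (Σ i, Fin (d i)) ℝ) (i j : Fin m) :
    Matrix (Fin (d i)) (Fin (d j)) ℝ :=
  Matrix.of fun a c => M ⟨i, a⟩ ⟨j, c⟩

theorem block_mul (M N : Matrix (Σ i, Fin (d i)) (Σ i, Fin (d i)) ℝ) (i j : Fin m) :
    block (M * N) i j = ∑ k, block M i k * block N k j := by
  ext a c
  simp only [block, Matrix.of_apply, Matrix.mul_apply, Fintype.sum_sigma, Matrix.sum_apply]

theorem block_restrictedAveraging (b : ∀ i, OrthonormalBasis (Fin (d i)) ℝ (U i))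
    (G : Digraph (Fin m)) (i j : Fin m) :
    block (restrictedAveraging b G) i j =
      averaging G i j • ((basisMatrix (b i))ᵀ * basisMatrix (b j)) := by
  ext a c
  simp only [block, restrictedAveraging, averagingBar, Matrix.of_apply, Matrix.mul_apply,
    Fintype.sum_prod_type, Matrix.transpose_apply, basisBar_apply, kroneckerMap_apply,
    Matrix.one_apply, Matrix.smul_apply, smul_eq_mul, ite_mul, zero_mul, mul_ite, mul_zero, mul_one,
    Finset.sum_ite_irrel, Finset.sum_const_zero, Finset.sum_ite_eq',
    Finset.mem_univ, if_true, Finset.mul_sum]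
  refine Finset.sum_congr rfl fun e _ => ?_
  ring

theorem mulVec_apply_eq_sum_block (M : Matrix (Σ i, Fin (d i)) (Σ i, Fin (d i)) ℝ)
    (x : (Σ i, Fin (d i)) → ℝ) (i : Fin m) :
    (fun a => (M *ᵥ x) ⟨i, a⟩) = ∑ j, block M i j *ᵥ fun c => x ⟨j, c⟩ := by
  funext a
  simp only [mulVec, dotProduct, Fintype.sum_sigma, Finset.sum_apply, block, Matrix.of_apply]

theorem restrictedAveraging_mulVec_apply (b : ∀ i, OrthonormalBasis (Fin (d i)) ℝ (U i))
    (G : Digraph (Fin m)) (x : (Σ i, Fin (d i)) → ℝ) (i : Fin m) :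
    (fun a => (restrictedAveraging b G *ᵥ x) ⟨i, a⟩) =
      (basisMatrix (b i))ᵀ *ᵥ ∑ j, averaging G i j • basisMatrix (b j) *ᵥ fun c => x ⟨j, c⟩ := by
  rw [mulVec_apply_eq_sum_block, mulVec_sum]
  refine Finset.sum_congr rfl fun j _ => ?_
  rw [block_restrictedAveraging, smul_mulVec, mulVec_smul, mulVec_mulVec]

/-- Since the columns of each `V i` are orthonormal, `R` is diagonal. -/
theorem weight_eq_diagonal (b : ∀ i, OrthonormalBasis (Fin (d i)) ℝ (U i)) (π : Fin m → ℝ) :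
    weight b π = Matrix.diagonal fun k => π k.1 := by
  have h : (Matrix.diagonal π ⊗ₖ (1 : Matrix (Fin n) (Fin n) ℝ)) * basisBar b =
      basisBar b * (Matrix.diagonal fun k => π k.1 : Matrix (Σ i, Fin (d i)) _ ℝ) := by
    ext ⟨i, a⟩ ⟨j, c⟩
    rw [← diagonal_one, diagonal_kronecker_diagonal, diagonal_mul, mul_diagonal, basisBar_apply]
    split_ifs with h
    · subst h; ring
    · ring
  rw [weight, Matrix.mul_assoc, h, ← Matrix.mul_assoc, basisBar_transpose_mul_self, Matrix.one_mul]

end Block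

/-! ### The weighted two-norm -/

section WeightedNorm

variable {ι : Type*} [Fintype ι] [DecidableEq ι] {ω : ι → ℝ}

/-- The similarity transformation that turns the norm weighted by `diagonal ω` into the spectral
norm. -/
def rescale (ω : ι → ℝ) (M : Matrix ι ι ℝ) : Matrix ι ι ℝ :=
  Matrix.diagonal (fun k => √(ω k)) * M * Matrix.diagonal (fun k => (√(ω k))⁻¹)

theorem diagonal_inv_sqrt_mul (hω : ∀ k, 0 < ω k) :
    Matrix.diagonal (fun k => (√(ω k))⁻¹) * Matrix.diagonal (fun k => √(ω k)) = 1 := by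
  rw [diagonal_mul_diagonal, ← diagonal_one]
  congr 1
  funext k
  exact inv_mul_cancel₀ (Real.sqrt_pos.2 (hω k)).ne'

theorem rescale_mul (hω : ∀ k, 0 < ω k) (M N : Matrix ι ι ℝ) :
    rescale ω (M * N) = rescale ω M * rescale ω N := by
  simp only [rescale, Matrix.mul_assoc]
  rw [← Matrix.mul_assoc (Matrix.diagonal _) (Matrix.diagonal _), diagonal_inv_sqrt_mul hω,
    Matrix.one_mul]

theorem diagonal_mul_rescale_mul_diagonal (hω : ∀ k, 0 < ω k) (M : Matrix ι ι ℝ) :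
    Matrix.diagonal (fun k => (√(ω k))⁻¹) * rescale ω M *
      Matrix.diagonal (fun k => √(ω k)) = M := by
  rw [rescale, Matrix.mul_assoc, Matrix.mul_assoc, Matrix.mul_assoc, diagonal_inv_sqrt_mul hω,
    Matrix.mul_one, ← Matrix.mul_assoc, diagonal_inv_sqrt_mul hω, Matrix.one_mul]

theorem dotProduct_diagonal_mulVec_self (hω : ∀ k, 0 < ω k) (x : ι → ℝ) :
    x ⬝ᵥ (Matrix.diagonal ω *ᵥ x) = (Matrix.diagonal (fun k => √(ω k)) *ᵥ x) ⬝ᵥ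
      (Matrix.diagonal (fun k => √(ω k)) *ᵥ x) := by
  simp only [dotProduct, mulVec_diagonal]
  refine Finset.sum_congr rfl fun k _ => ?_
  have := Real.mul_self_sqrt (hω k).le
  linear_combination (x k * x k) * this.symm

theorem rescale_mulVec (hω : ∀ k, 0 < ω k) (M : Matrix ι ι ℝ) (x : ι → ℝ) :
    rescale ω M *ᵥ (Matrix.diagonal (fun k => √(ω k)) *ᵥ x) =
      Matrix.diagonal (fun k => √(ω k)) *ᵥ (M *ᵥ x) := by
  rw [rescale, mulVec_mulVec, mulVec_mulVec, Matrix.mul_assoc, diagonal_inv_sqrt_mul hω,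
    Matrix.mul_one]

theorem exists_diagonal_mulVec_eq (hω : ∀ k, 0 < ω k) (y : ι → ℝ) :
    ∃ x, Matrix.diagonal (fun k => √(ω k)) *ᵥ x = y := by
  refine ⟨Matrix.diagonal (fun k => (√(ω k))⁻¹) *ᵥ y, ?_⟩
  funext k
  simp only [mulVec_diagonal]
  rw [mul_inv_cancel_left₀ (Real.sqrt_pos.2 (hω k)).ne']

theorem weightedNorm_diagonal (hω : ∀ k, 0 < ω k) (M : Matrix ι ι ℝ) :
    weightedNorm (Matrix.diagonal ω) M = ‖rescale ω M‖ := by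
  have hset : {c : ℝ | 0 ≤ c ∧ ∀ x : ι → ℝ, √((M *ᵥ x) ⬝ᵥ (Matrix.diagonal ω *ᵥ (M *ᵥ x))) ≤
      c * √(x ⬝ᵥ (Matrix.diagonal ω *ᵥ x))} = Set.Ici ‖rescale ω M‖ := by
    ext c
    simp only [Set.mem_ofPred_eq, Set.mem_Ici, dotProduct_diagonal_mulVec_self hω,
      ← norm_toLp_eq_sqrt, ← rescale_mulVec hω]
    refine ⟨fun ⟨hc, h⟩ => l2_opNorm_le hc fun y => ?_, fun h => ⟨(norm_nonneg _).trans h,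
      fun x => (norm_toLp_mulVec_le _ _).trans (mul_le_mul_of_nonneg_right h (norm_nonneg _))⟩⟩
    obtain ⟨x, rfl⟩ := exists_diagonal_mulVec_eq hω y
    exact h x
  rw [weightedNorm, hset, csInf_Ici]

theorem weightedNorm_diagonal_mul_le (hω : ∀ k, 0 < ω k) (M N : Matrix ι ι ℝ) :
    weightedNorm (Matrix.diagonal ω) (M * N) ≤
      weightedNorm (Matrix.diagonal ω) M * weightedNorm (Matrix.diagonal ω) N := by
  simp only [weightedNorm_diagonal hω, rescale_mul hω]
  exact l2_opNorm_mul _ _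

theorem exists_norm_le_mul_weightedNorm (hω : ∀ k, 0 < ω k) :
    ∃ c : ℝ, 0 ≤ c ∧ ∀ M : Matrix ι ι ℝ, ‖M‖ ≤ c * weightedNorm (Matrix.diagonal ω) M := by
  refine ⟨‖(Matrix.diagonal (fun k => (√(ω k))⁻¹) : Matrix ι ι ℝ)‖ *
    ‖(Matrix.diagonal (fun k => √(ω k)) : Matrix ι ι ℝ)‖, by positivity, fun M => ?_⟩
  conv_lhs => rw [← diagonal_mul_rescale_mul_diagonal hω M]
  rw [weightedNorm_diagonal hω, mul_right_comm]
  exact (l2_opNorm_mul _ _).trans (mul_le_mul_of_nonneg_right (l2_opNorm_mul _ _) (norm_nonneg _))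

theorem weightedNorm_diagonal_nonneg (hω : ∀ k, 0 < ω k) (M : Matrix ι ι ℝ) :
    0 ≤ weightedNorm (Matrix.diagonal ω) M := by
  rw [weightedNorm_diagonal hω]
  exact norm_nonneg _

theorem weightedNorm_diagonal_lt_one (hω : ∀ k, 0 < ω k) {M : Matrix ι ι ℝ}
    (h : ∀ x, x ≠ 0 → (M *ᵥ x) ⬝ᵥ (Matrix.diagonal ω *ᵥ (M *ᵥ x)) <
      x ⬝ᵥ (Matrix.diagonal ω *ᵥ x)) : weightedNorm (Matrix.diagonal ω) M < 1 := by
  rw [weightedNorm_diagonal hω]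
  refine l2_opNorm_lt_one fun y hy => ?_
  obtain ⟨x, rfl⟩ := exists_diagonal_mulVec_eq hω y
  rw [rescale_mulVec hω, ← dotProduct_diagonal_mulVec_self hω, ← dotProduct_diagonal_mulVec_self hω]
  refine h x ?_
  rintro rfl
  simp at hy

end WeightedNorm

/-! ### Contraction in the weighted two-norm -/

section Contraction

variable {m n : ℕ}

/-- The variance identity for a weighted average of vectors. -/
theorem sum_mul_dotProduct_self_eq {w : Fin m → ℝ} (hw : ∑ j, w j = 1) (v : Fin m → Fin n → ℝ) :
    ∑ j, w j * (v j ⬝ᵥ v j) = (∑ j, w j • v j) ⬝ᵥ (∑ j, w j • v j) +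
      ∑ j, w j * ((v j - ∑ k, w k • v k) ⬝ᵥ (v j - ∑ k, w k • v k)) := by
  set u := ∑ j, w j • v j with hu
  have h1 : ∑ j, w j * (v j ⬝ᵥ u) = u ⬝ᵥ u := by
    conv_rhs => rw [hu, sum_dotProduct]
    simp only [smul_dotProduct, smul_eq_mul, hu]
  have h2 : ∀ j, w j * ((v j - u) ⬝ᵥ (v j - u)) =
      w j * (v j ⬝ᵥ v j) - 2 * (w j * (v j ⬝ᵥ u)) + w j * (u ⬝ᵥ u) := fun j => by
    rw [sub_dotProduct, dotProduct_sub, dotProduct_sub, dotProduct_comm u (v j)]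
    ring
  rw [Finset.sum_congr rfl fun j _ => h2 j, Finset.sum_add_distrib, Finset.sum_sub_distrib,
    ← Finset.mul_sum, h1, ← Finset.sum_mul, hw]
  ring

variable {d : Fin m → ℕ} {U : Fin m → Submodule ℝ (EuclideanSpace ℝ (Fin n))}
  (b : ∀ i, OrthonormalBasis (Fin (d i)) ℝ (U i)) {G : Digraph (Fin m)} {π : Fin m → ℝ}

theorem dotProduct_diagonal_sigma (ω : Fin m → ℝ) (x : (Σ i, Fin (d i)) → ℝ) :
    x ⬝ᵥ (Matrix.diagonal (fun k => ω k.1) *ᵥ x) =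
      ∑ i, ω i * ((fun a => x ⟨i, a⟩) ⬝ᵥ fun a => x ⟨i, a⟩) := by
  simp only [dotProduct, mulVec_diagonal, Fintype.sum_sigma, Finset.mul_sum]
  exact Finset.sum_congr rfl fun i _ => Finset.sum_congr rfl fun a _ => by ring

/-- Averaging does not increase the weighted norm, by convexity of the square. If it preserves it,
then neighbors agree, hence all agents agree on a vector in the intersection of the `U i`. -/
theorem weightedNorm_restrictedAveraging_lt_one (hG : IsNeighborGraph G)
    (hπ : IsPerronVector G π) (hU : ⨅ i, U i = ⊥) :
    weightedNorm (weight b π) (restrictedAveraging b G) < 1 := by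
  rw [weight_eq_diagonal]
  have hω : ∀ k : (Σ i, Fin (d i)), 0 < π k.1 := fun k => hπ.pos k.1
  have key := weightedNorm_diagonal_lt_one hω (M := restrictedAveraging b G)
  refine key fun x hx => ?_
  by_contra hnot
  rw [not_lt] at hnot
  apply hx
  -- the vectors `v j ∈ U j` of the agents and their local averages `u i`
  set v : Fin m → Fin n → ℝ := fun j => basisMatrix (b j) *ᵥ fun c => x ⟨j, c⟩ with hv
  set u : Fin m → Fin n → ℝ := fun i => ∑ j, averaging G i j • v j with hu
  have hnn : ∀ y : Fin n → ℝ, 0 ≤ y ⬝ᵥ y := fun y =>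
    Finset.sum_nonneg fun i _ => mul_self_nonneg _
  have hvar : ∀ i, 0 ≤ ∑ j, averaging G i j * ((v j - u i) ⬝ᵥ (v j - u i)) := fun i =>
    Finset.sum_nonneg fun j _ => mul_nonneg (averaging_nonneg G i j) (hnn _)
  have hvv : ∑ i, π i * (v i ⬝ᵥ v i) = ∑ i, π i * ∑ j, averaging G i j * (v j ⬝ᵥ v j) := by
    simp only [Finset.mul_sum]
    rw [Finset.sum_comm]
    refine Finset.sum_congr rfl fun j _ => ?_
    simp only [← mul_assoc]
    rw [← Finset.sum_mul, hπ.sum_mul_averaging]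
  rw [dotProduct_diagonal_sigma, dotProduct_diagonal_sigma] at hnot
  have hle : ∑ i, π i * (v i ⬝ᵥ v i) ≤ ∑ i, π i * (u i ⬝ᵥ u i) := by
    calc ∑ i, π i * (v i ⬝ᵥ v i)
        = ∑ i, π i * ((fun a => x ⟨i, a⟩) ⬝ᵥ fun a => x ⟨i, a⟩) :=
          Finset.sum_congr rfl fun i _ => by rw [hv, dotProduct_basisMatrix_mulVec_self]
      _ ≤ _ := hnot
      _ ≤ _ := Finset.sum_le_sum fun i _ => by
          rw [restrictedAveraging_mulVec_apply]
          exact mul_le_mul_of_nonneg_left (basisMatrix_transpose_contraction (b i) _) (hπ.pos i).le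
  -- the weighted variances vanish, as they are the loss in the convexity inequality
  have hzero : ∑ i, π i * ∑ j, averaging G i j * ((v j - u i) ⬝ᵥ (v j - u i)) = 0 := by
    refine le_antisymm ?_ (Finset.sum_nonneg fun i _ => mul_nonneg (hπ.pos i).le (hvar i))
    rw [hvv] at hle
    simp only [fun i => sum_mul_dotProduct_self_eq (hG.sum_averaging i) v, mul_add,
      Finset.sum_add_distrib] at hle
    linarith
  have hnb : ∀ i j, G.Adj j i → v j = u i := fun i j hji => by
    have h1 := (Finset.sum_eq_zero_iff_of_nonneg
      fun i _ => mul_nonneg (hπ.pos i).le (hvar i)).1 hzero i (Finset.mem_univ i)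
    have h2 := (Finset.sum_eq_zero_iff_of_nonneg fun j _ =>
      mul_nonneg (averaging_nonneg G i j) (hnn _)).1
      ((mul_eq_zero.1 h1).resolve_left (hπ.pos i).ne') j (Finset.mem_univ j)
    exact sub_eq_zero.1 (dotProduct_self_eq_zero.1
      ((mul_eq_zero.1 h2).resolve_left (averaging_pos hji).ne'))
  have hall : ∀ i j, v j = v i := fun i j => by
    induction hG.stronglyConnected j i using Relation.ReflTransGen.head_induction_on with
    | refl => rfl
    | head h _ ih => rw [hnb _ _ h, ← hnb _ _ (hG.self_neighbor _), ih]
  funext ⟨i, a⟩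
  have hvi : WithLp.toLp 2 (v i) ∈ ⨅ j, U j := (Submodule.mem_iInf _).2 fun j => by
    rw [hall j i]
    exact basisMatrix_mulVec_mem (b j) _
  rw [hU, Submodule.mem_bot, WithLp.toLp_eq_zero] at hvi
  have hx0 : (fun a => x ⟨i, a⟩) = 0 := by
    rw [← dotProduct_self_eq_zero, ← dotProduct_basisMatrix_mulVec_self (b i)]
    change v i ⬝ᵥ v i = 0
    rw [hvi, dotProduct_zero]
  exact congrFun hx0 a

theorem posDef_weight (hπ : ∀ i, 0 < π i) : (weight b π).PosDef := by
  rw [weight_eq_diagonal]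
  exact PosDef.diagonal fun k => hπ k.1

end Contraction

/-! ### Covering walks in strongly connected relations -/

/-- `CoveringWalk R p T i j`: there is a walk of length `p` from `i` to `j` along `R` that visits
every element of `T` (and possibly others). -/
inductive CoveringWalk {α : Type*} (R : α → α → Prop) : ℕ → Set α → α → α → Prop
  | nil {T : Set α} {i : α} (hT : T ⊆ {i}) : CoveringWalk R 0 T i i
  | cons {p : ℕ} {T T' : Set α} {i k j : α} (h : R i k) (w : CoveringWalk R p T' k j)
      (hT : T ⊆ insert i T') : CoveringWalk R (p + 1) T i j

namespace CoveringWalk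

variable {α : Type*} {R : α → α → Prop} {p q : ℕ} {T T' : Set α} {i j k : α}

theorem mono (w : CoveringWalk R p T i j) (h : T' ⊆ T) : CoveringWalk R p T' i j := by
  cases w with
  | nil hT => exact .nil (h.trans hT)
  | cons hR w hT => exact .cons hR w (h.trans hT)

theorem insert_start (w : CoveringWalk R p T i j) : CoveringWalk R p (insert i T) i j := by
  cases w with
  | nil hT => exact .nil (Set.insert_subset rfl hT)
  | cons hR w hT => exact .cons hR w (Set.insert_subset (Set.mem_insert _ _) hT)

theorem append (w : CoveringWalk R p T i k) (w' : CoveringWalk R q T' k j) :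
    CoveringWalk R (p + q) (T ∪ T') i j := by
  induction w with
  | nil hT =>
    rw [zero_add]
    refine w'.insert_start.mono (Set.union_subset (hT.trans ?_) (Set.subset_insert _ _))
    exact Set.singleton_subset_iff.2 (Set.mem_insert _ _)
  | cons h _ hT ih =>
    rw [Nat.succ_add_eq_add_succ]
    refine .cons h (ih w') (Set.union_subset (hT.trans ?_) ?_)
    · exact Set.insert_subset_insert Set.subset_union_left
    · exact Set.subset_union_right.trans (Set.subset_insert _ _)

theorem add_loops (hR : ∀ i, R i i) (w : CoveringWalk R p T i j) (l : ℕ) :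
    CoveringWalk R (p + l) T i j := by
  induction l with
  | zero => exact w
  | succ l ih => exact .cons (hR i) ih (Set.subset_insert _ _)

end CoveringWalk

section Walks

variable {m : ℕ} {R : Fin m → Fin m → Prop}

/-- Any two vertices are joined by a walk of length exactly `m - 1`: the set of starting points of
walks of length `p` to `j` grows strictly with `p` until it is everything. -/
theorem coveringWalk_card_sub_one (hR : ∀ i, R i i) (hconn : ∀ i j, Relation.ReflTransGen R i j)
    (i j : Fin m) : CoveringWalk R (m - 1) ∅ i j := by
  set S : ℕ → Set (Fin m) := fun p => {i | CoveringWalk R p ∅ i j} with hS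
  have hmono : ∀ p, S p ⊆ S (p + 1) := fun p x hx => CoveringWalk.add_loops hR hx 1
  have hcard : ∀ p < m, p + 1 ≤ (S p).ncard := by
    intro p
    induction p with
    | zero =>
      intro _
      exact (Set.ncard_pos (Set.toFinite _)).2 ⟨j, .nil (Set.empty_subset _)⟩
    | succ p ih =>
      intro hp
      by_cases heq : S p = Set.univ
      · have : S (p + 1) = Set.univ := Set.eq_univ_of_univ_subset (heq ▸ hmono p)
        rw [this, Set.ncard_univ, Nat.card_fin]
        omega
      · have hne : S p ≠ S (p + 1) := fun h => heq <| Set.eq_univ_of_forall fun x => by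
          have hj : j ∈ S p := by
            have := CoveringWalk.add_loops hR
              (CoveringWalk.nil (R := R) (i := j) (Set.empty_subset _)) p
            rwa [zero_add] at this
          induction hconn x j using Relation.ReflTransGen.head_induction_on with
          | refl => exact hj
          | head hab _ ihx =>
            rw [h]
            exact CoveringWalk.cons hab ihx (Set.empty_subset _)
        have := Set.ncard_lt_ncard ((hmono p).ssubset_of_ne hne)
        have := ih (by omega)
        omega
  have hm : 0 < m := i.pos
  have huniv : S (m - 1) = Set.univ := by
    refine Set.eq_univ_iff_ncard _ |>.2 ?_
    rw [Nat.card_fin]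
    have h1 := hcard (m - 1) (by omega)
    have h2 := Set.ncard_le_card (S (m - 1))
    rw [Nat.card_fin] at h2
    omega
  have : i ∈ S (m - 1) := huniv ▸ Set.mem_univ i
  exact this

theorem exists_coveringWalk_list (hR : ∀ i, R i i) (hconn : ∀ i j, Relation.ReflTransGen R i j)
    (l : List (Fin m)) (i : Fin m) :
    ∃ j, CoveringWalk R ((m - 1) * l.length) {x | x ∈ l} i j := by
  induction l generalizing i with
  | nil => exact ⟨i, .nil (by simp)⟩
  | cons v l ih =>
    obtain ⟨j, w⟩ := ih v
    refine ⟨j, ?_⟩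
    have := (coveringWalk_card_sub_one hR hconn i v).append w.insert_start
    rw [List.length_cons, Nat.mul_succ, add_comm]
    refine this.mono fun x hx => ?_
    simpa using hx

/-- From every vertex, some walk of length `p ≥ (m - 1) ^ 2` visits all vertices: the other `m - 1`
vertices are visited one after another, in at most `m - 1` steps each. -/
theorem exists_coveringWalk_univ (hR : ∀ i, R i i) (hconn : ∀ i j, Relation.ReflTransGen R i j)
    {p : ℕ} (hp : (m - 1) ^ 2 ≤ p) (i : Fin m) : ∃ j, CoveringWalk R p Set.univ i j := by
  obtain ⟨j, w⟩ := exists_coveringWalk_list hR hconn (Finset.univ.erase i).toList i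
  have hlen : (Finset.univ.erase i).toList.length = m - 1 := by
    rw [Finset.length_toList, Finset.card_erase_of_mem (Finset.mem_univ i), Finset.card_univ,
      Fintype.card_fin]
  rw [hlen, ← sq] at w
  refine ⟨j, ?_⟩
  have := (w.insert_start.add_loops hR (p - (m - 1) ^ 2)).mono (T' := Set.univ) fun x _ => by
    by_cases h : x = i <;> simp [h]
  rwa [Nat.add_sub_cancel' hp] at this

end Walks

/-! ### The mixed norm -/

section MixedNorm

variable {m : ℕ} {d : Fin m → ℕ}

theorem sum_norm_block_le_mixedNorm (M : Matrix (Σ i, Fin (d i)) (Σ i, Fin (d i)) ℝ) (i : Fin m) :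
    ∑ j, ‖block M i j‖ ≤ mixedNorm M :=
  le_ciSup (f := fun i => ∑ j, ‖block M i j‖) (Set.finite_range _).bddAbove i

theorem mixedNorm_nonneg (M : Matrix (Σ i, Fin (d i)) (Σ i, Fin (d i)) ℝ) : 0 ≤ mixedNorm M :=
  Real.iSup_nonneg fun _ => Finset.sum_nonneg fun _ _ => norm_nonneg _

theorem mixedNorm_le {M : Matrix (Σ i, Fin (d i)) (Σ i, Fin (d i)) ℝ} {c : ℝ} (hc : 0 ≤ c)
    (h : ∀ i, ∑ j, ‖block M i j‖ ≤ c) : mixedNorm M ≤ c :=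
  Real.iSup_le h hc

theorem mixedNorm_lt (hm : 0 < m) {M : Matrix (Σ i, Fin (d i)) (Σ i, Fin (d i)) ℝ} {c : ℝ}
    (h : ∀ i, ∑ j, ‖block M i j‖ < c) : mixedNorm M < c := by
  have : Nonempty (Fin m) := ⟨⟨0, hm⟩⟩
  obtain ⟨i, hi⟩ := exists_eq_ciSup_of_finite (f := fun i => ∑ j, ‖block M i j‖)
  exact hi.symm.trans_lt (h i)

theorem mixedNorm_mul_le (M N : Matrix (Σ i, Fin (d i)) (Σ i, Fin (d i)) ℝ) :
    mixedNorm (M * N) ≤ mixedNorm M * mixedNorm N := by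
  refine mixedNorm_le (mul_nonneg (mixedNorm_nonneg M) (mixedNorm_nonneg N)) fun i => ?_
  calc ∑ j, ‖block (M * N) i j‖
      ≤ ∑ j, ∑ k, ‖block M i k‖ * ‖block N k j‖ := Finset.sum_le_sum fun j _ => by
        rw [block_mul]
        exact (norm_sum_le _ _).trans (Finset.sum_le_sum fun k _ => l2_opNorm_mul _ _)
    _ = ∑ k, ‖block M i k‖ * ∑ j, ‖block N k j‖ := by
        rw [Finset.sum_comm]
        simp only [Finset.mul_sum]
    _ ≤ ∑ k, ‖block M i k‖ * mixedNorm N := Finset.sum_le_sum fun k _ =>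
        mul_le_mul_of_nonneg_left (sum_norm_block_le_mixedNorm N k) (norm_nonneg _)
    _ ≤ mixedNorm M * mixedNorm N := by
        rw [← Finset.sum_mul]
        exact mul_le_mul_of_nonneg_right (sum_norm_block_le_mixedNorm M i) (mixedNorm_nonneg N)

theorem exists_norm_le_mul_mixedNorm :
    ∃ c : ℝ, 0 ≤ c ∧ ∀ M : Matrix (Σ i, Fin (d i)) (Σ i, Fin (d i)) ℝ, ‖M‖ ≤ c * mixedNorm M := by
  obtain ⟨c, hc, h⟩ :=
    exists_l2_opNorm_le_of_abs_entry_le (ι := Σ i, Fin (d i)) (κ := Σ i, Fin (d i))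
  refine ⟨c, hc, fun M => h M _ ?_⟩
  rintro ⟨i, a⟩ ⟨j, e⟩
  calc |M ⟨i, a⟩ ⟨j, e⟩| = |block M i j a e| := rfl
    _ ≤ ‖block M i j‖ := abs_entry_le_l2_opNorm _ _ _
    _ ≤ ∑ j, ‖block M i j‖ :=
      Finset.single_le_sum (f := fun j => ‖block M i j‖) (fun _ _ => norm_nonneg _)
        (Finset.mem_univ j)
    _ ≤ mixedNorm M := sum_norm_block_le_mixedNorm M i

end MixedNorm

/-! ### Contraction in the mixed norm -/

section MixedContraction

variable {m n : ℕ} {d : Fin m → ℕ} {U : Fin m → Submodule ℝ (EuclideanSpace ℝ (Fin n))}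
  (b : ∀ i, OrthonormalBasis (Fin (d i)) ℝ (U i)) {G : Digraph (Fin m)}

theorem block_restrictedAveraging_pow_succ (p : ℕ) (i j : Fin m) :
    block (restrictedAveraging b G ^ (p + 1)) i j = ∑ k, averaging G i k •
      ((basisMatrix (b i))ᵀ * basisMatrix (b k) * block (restrictedAveraging b G ^ p) k j) := by
  rw [pow_succ', block_mul]
  refine Finset.sum_congr rfl fun k _ => ?_
  rw [block_restrictedAveraging, Matrix.smul_mul]

theorem norm_smul_transpose_mul_mul_le (i k : Fin m) {ι : Type*} [Fintype ι] [DecidableEq ι]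
    (M : Matrix (Fin (d k)) ι ℝ) :
    ‖averaging G i k • ((basisMatrix (b i))ᵀ * basisMatrix (b k) * M)‖ ≤ averaging G i k * ‖M‖ := by
  rw [norm_smul, Real.norm_of_nonneg (averaging_nonneg G i k)]
  refine mul_le_mul_of_nonneg_left ((l2_opNorm_mul _ _).trans ?_) (averaging_nonneg G i k)
  exact mul_le_of_le_one_left (norm_nonneg _) (norm_basisMatrix_transpose_mul_le _ _)

theorem block_one_self (j : Fin m) :
    block (1 : Matrix (Σ i, Fin (d i)) (Σ i, Fin (d i)) ℝ) j j = 1 := by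
  ext a c
  simp [block, Matrix.one_apply]

theorem norm_block_restrictedAveraging_pow_le (p : ℕ) (i j : Fin m) :
    ‖block (restrictedAveraging b G ^ p) i j‖ ≤ (averaging G ^ p) i j := by
  induction p generalizing i with
  | zero =>
    rw [pow_zero, pow_zero]
    by_cases h : i = j
    · subst h
      rw [block_one_self, Matrix.one_apply_eq]
      exact l2_opNorm_le_one fun x => by rw [one_mulVec]
    · have : block (1 : Matrix (Σ i, Fin (d i)) (Σ i, Fin (d i)) ℝ) i j = 0 := by
        ext a c
        simp [block, h]
      rw [this, norm_zero, Matrix.one_apply_ne h]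
  | succ p ih =>
    rw [block_restrictedAveraging_pow_succ, pow_succ', Matrix.mul_apply]
    refine (norm_sum_le _ _).trans (Finset.sum_le_sum fun k _ => ?_)
    exact (norm_smul_transpose_mul_mul_le b i k _).trans
      (mul_le_mul_of_nonneg_left (ih k) (averaging_nonneg G i k))

/-- A walk from `i` to `j` contributes to the `(i, j)` block of the `p`-th power a positive multiple
of a contraction `X`, a product of projections along the walk. Vectors whose norm `X` preserves lie
in all the subspaces that the walk visits. The other walks contribute at most their weights. -/
theorem exists_block_restrictedAveraging_pow_eq {p : ℕ} {T : Set (Fin m)} {i j : Fin m}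
    (hw : CoveringWalk (fun i k => G.Adj k i) p T i j) :
    ∃ (w : ℝ) (X E : Matrix (Fin (d i)) (Fin (d j)) ℝ), 0 < w ∧
      block (restrictedAveraging b G ^ p) i j = w • X + E ∧
      ‖E‖ ≤ (averaging G ^ p) i j - w ∧ ‖X‖ ≤ 1 ∧
      ∀ x, x ⬝ᵥ x ≤ (X *ᵥ x) ⬝ᵥ (X *ᵥ x) →
        basisMatrix (b i) *ᵥ (X *ᵥ x) = basisMatrix (b j) *ᵥ x ∧
          ∀ k ∈ T, WithLp.toLp 2 (basisMatrix (b j) *ᵥ x) ∈ U k := by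
  induction hw with
  | nil hT =>
    rename_i i
    refine ⟨1, 1, 0, one_pos, ?_, ?_, l2_opNorm_le_one fun x => by rw [one_mulVec], ?_⟩
    · rw [pow_zero, block_one_self, one_smul, add_zero]
    · rw [pow_zero, Matrix.one_apply_eq, norm_zero, sub_self]
    · refine fun x _ => ⟨by rw [one_mulVec], fun k hk => ?_⟩
      rw [Set.mem_singleton_iff.1 (hT hk)]
      exact basisMatrix_mulVec_mem _ _
  | cons h hw hT ih =>
    rename_i p T T' i k j
    obtain ⟨w, X, E, hw0, hB, hE, hX1, hX⟩ := ih
    have hs := averaging_pos h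
    refine ⟨averaging G i k * w, (basisMatrix (b i))ᵀ * basisMatrix (b k) * X,
      averaging G i k • ((basisMatrix (b i))ᵀ * basisMatrix (b k) * E) +
        ∑ l ∈ Finset.univ.erase k, averaging G i l •
          ((basisMatrix (b i))ᵀ * basisMatrix (b l) * block (restrictedAveraging b G ^ p) l j),
      mul_pos hs hw0, ?_, ?_, ?_, ?_⟩
    · rw [block_restrictedAveraging_pow_succ, ← Finset.add_sum_erase _ _ (Finset.mem_univ k), hB,
        Matrix.mul_add, smul_add, Matrix.mul_smul, smul_smul, add_assoc]
    · rw [pow_succ', Matrix.mul_apply, ← Finset.add_sum_erase _ _ (Finset.mem_univ k)]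
      have h1 := (norm_smul_transpose_mul_mul_le (G := G) b i k E).trans
        (mul_le_mul_of_nonneg_left hE hs.le)
      have h2 : ‖∑ l ∈ Finset.univ.erase k, averaging G i l •
          ((basisMatrix (b i))ᵀ * basisMatrix (b l) * block (restrictedAveraging b G ^ p) l j)‖ ≤
          ∑ l ∈ Finset.univ.erase k, averaging G i l * (averaging G ^ p) l j :=
        (norm_sum_le _ _).trans (Finset.sum_le_sum fun l _ =>
          (norm_smul_transpose_mul_mul_le b i l _).trans (mul_le_mul_of_nonneg_left
            (norm_block_restrictedAveraging_pow_le b p l j) (averaging_nonneg G i l)))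
      refine (norm_add_le _ _).trans ((add_le_add h1 h2).trans_eq ?_)
      ring
    · refine (l2_opNorm_mul _ _).trans ((mul_le_mul_of_nonneg_right
        (norm_basisMatrix_transpose_mul_le (b i) (b k)) (norm_nonneg X)).trans ?_)
      rwa [one_mul]
    · intro x hx
      rw [← mulVec_mulVec, ← mulVec_mulVec] at hx
      have hstep := basisMatrix_transpose_contraction (b i) (basisMatrix (b k) *ᵥ (X *ᵥ x))
      obtain ⟨hVX, hmem⟩ := hX x (hx.trans (hstep.trans_eq
        (dotProduct_basisMatrix_mulVec_self (b k) _)))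
      rw [hVX] at hx
      rw [← dotProduct_basisMatrix_mulVec_self (b j) x] at hx
      have hfix := projectionMatrix_mulVec_eq_self_of_le (b i) hx
      constructor
      · rw [← mulVec_mulVec, ← mulVec_mulVec, hVX, mulVec_mulVec, basisMatrix_mul_transpose, hfix]
      · intro l hl
        rcases hT hl with rfl | hl
        · rw [← hfix]
          exact projectionMatrix_mulVec_mem _
        · exact hmem l hl

theorem IsNeighborGraph.sum_averaging_pow (hG : IsNeighborGraph G) (p : ℕ) (i : Fin m) :
    ∑ j, (averaging G ^ p) i j = 1 := by
  induction p generalizing i with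
  | zero => simp [Matrix.one_apply]
  | succ p ih =>
    simp only [pow_succ', Matrix.mul_apply]
    rw [Finset.sum_comm]
    simp only [← Finset.mul_sum, ih, mul_one, hG.sum_averaging]

theorem mixedNorm_restrictedAveraging_pow_lt_one (hG : IsNeighborGraph G) (hU : ⨅ i, U i = ⊥)
    (hm : 0 < m) {p : ℕ} (hp : (m - 1) ^ 2 ≤ p) :
    mixedNorm (restrictedAveraging b G ^ p) < 1 := by
  refine mixedNorm_lt hm fun i => ?_
  obtain ⟨j, hw⟩ := exists_coveringWalk_univ (R := fun i k => G.Adj k i) hG.self_neighbor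
    (fun i j => Relation.reflTransGen_swap.2 (hG.stronglyConnected j i)) hp i
  obtain ⟨w, X, E, hw0, hB, hE, hX1, hX⟩ := exists_block_restrictedAveraging_pow_eq b hw
  have hXlt : ‖X‖ < 1 := l2_opNorm_lt_one fun x hx => by
    by_contra hnot
    apply hx
    have hmem : WithLp.toLp 2 (basisMatrix (b j) *ᵥ x) ∈ ⨅ k, U k :=
      (Submodule.mem_iInf _).2 fun k => (hX x (not_lt.1 hnot)).2 k (Set.mem_univ k)
    rw [hU, Submodule.mem_bot, WithLp.toLp_eq_zero] at hmem
    rw [← dotProduct_self_eq_zero, ← dotProduct_basisMatrix_mulVec_self (b j), hmem,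
      dotProduct_zero]
  rw [← hG.sum_averaging_pow p i]
  refine Finset.sum_lt_sum (fun k _ => norm_block_restrictedAveraging_pow_le b p i k)
    ⟨j, Finset.mem_univ j, ?_⟩
  rw [hB]
  refine (norm_add_le _ _).trans_lt ?_
  rw [norm_smul, Real.norm_of_nonneg hw0.le]
  have := mul_lt_mul_of_pos_left hXlt hw0
  linarith

end MixedContraction

/-! ### Perturbed products of contractions -/

section Recursion

variable {ι κ : Type*} [Fintype ι] [DecidableEq ι] [Fintype κ] [DecidableEq κ]

theorem le_mul_pow_of_submultiplicative {N : Matrix ι ι ℝ → ℝ} (hN0 : ∀ X, 0 ≤ N X)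
    (hmul : ∀ X Y, N (X * Y) ≤ N X * N Y) (X Y : Matrix ι ι ℝ) (k : ℕ) :
    N (X * Y ^ k) ≤ N X * N Y ^ k := by
  induction k with
  | zero => simp
  | succ k ih =>
    rw [pow_succ, ← mul_assoc, pow_succ, ← mul_assoc]
    exact (hmul _ _).trans (mul_le_mul_of_nonneg_right ih (hN0 Y))

/-- The product `E (s + k - 1) ⋯ E (s + 1) * E s`. -/
def propagator (E : ℕ → Matrix ι ι ℝ) : ℕ → ℕ → Matrix ι ι ℝ
  | _, 0 => 1
  | s, k + 1 => propagator E (s + 1) k * E s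

/-- If the factors `E τ` are bounded by `ν < μ` in some submultiplicative norm, then solutions of
`Y (τ + 1) = E τ * Y τ + W τ` with `W τ = O(μ ^ τ)` are `O(μ ^ τ)`. -/
theorem exists_norm_le_of_recursion {N : Matrix ι ι ℝ → ℝ} (hN0 : ∀ X, 0 ≤ N X)
    (hmul : ∀ X Y, N (X * Y) ≤ N X * N Y) {c : ℝ} (hc : 0 ≤ c) (hNc : ∀ X, ‖X‖ ≤ c * N X)
    {ν μ : ℝ} (hν : 0 ≤ ν) (hνμ : ν < μ) {E : ℕ → Matrix ι ι ℝ} (hE : ∀ s, N (E s) ≤ ν)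
    {Y W : ℕ → Matrix ι κ ℝ} (hY : ∀ τ, Y (τ + 1) = E τ * Y τ + W τ) {w : ℝ}
    (hW : ∀ τ, ‖W τ‖ ≤ w * μ ^ τ) : ∃ K, ∀ τ, ‖Y τ‖ ≤ K * μ ^ τ := by
  have hμ : 0 ≤ μ := hν.trans hνμ.le
  have hΨN : ∀ k s, N (propagator E s k) ≤ N 1 * ν ^ k := by
    intro k
    induction k with
    | zero => intro s; simp [propagator]
    | succ k ih =>
      intro s
      rw [propagator, pow_succ, ← mul_assoc]
      exact (hmul _ _).trans (mul_le_mul (ih _) (hE s) (hN0 _)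
        (mul_nonneg (hN0 1) (pow_nonneg hν k)))
  have hC : 0 ≤ c * N 1 := mul_nonneg hc (hN0 1)
  have hΨ : ∀ k s, ‖propagator E s k‖ ≤ c * N 1 * ν ^ k := fun k s => by
    rw [mul_assoc]
    exact (hNc _).trans (mul_le_mul_of_nonneg_left (hΨN k s) hc)
  -- `K` dominates the initial value and the fixed point of `K ↦ (K * ν + c * N 1 * w) / μ`
  set K := max (c * N 1 * ‖Y 0‖) (c * N 1 * w / (μ - ν)) with hK
  have hKw : K * ν + c * N 1 * w ≤ K * μ := by
    have := (div_le_iff₀ (sub_pos.2 hνμ)).1 (le_max_right (c * N 1 * ‖Y 0‖) (c * N 1 * w / (μ - ν)))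
    rw [← hK] at this
    linarith
  have key : ∀ τ k, ‖propagator E τ k * Y τ‖ ≤ K * μ ^ τ * ν ^ k := by
    intro τ
    induction τ with
    | zero =>
      intro k
      rw [pow_zero, mul_one]
      calc ‖propagator E 0 k * Y 0‖ ≤ ‖propagator E 0 k‖ * ‖Y 0‖ := l2_opNorm_mul _ _
        _ ≤ c * N 1 * ν ^ k * ‖Y 0‖ := mul_le_mul_of_nonneg_right (hΨ k 0) (norm_nonneg _)
        _ = c * N 1 * ‖Y 0‖ * ν ^ k := by ring
        _ ≤ K * ν ^ k := mul_le_mul_of_nonneg_right (le_max_left _ _) (pow_nonneg hν k)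
    | succ τ ih =>
      intro k
      have h1 : propagator E (τ + 1) k * Y (τ + 1) =
          propagator E τ (k + 1) * Y τ + propagator E (τ + 1) k * W τ := by
        rw [hY, Matrix.mul_add, propagator, Matrix.mul_assoc]
      have h2 : ‖propagator E (τ + 1) k * W τ‖ ≤ c * N 1 * ν ^ k * (w * μ ^ τ) :=
        (l2_opNorm_mul _ _).trans (mul_le_mul (hΨ k _) (hW τ) (norm_nonneg _)
          (mul_nonneg hC (pow_nonneg hν k)))
      rw [h1]
      calc _ ≤ K * μ ^ τ * ν ^ (k + 1) + c * N 1 * ν ^ k * (w * μ ^ τ) :=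
            (norm_add_le _ _).trans (add_le_add (ih _) h2)
        _ = (K * ν + c * N 1 * w) * (μ ^ τ * ν ^ k) := by ring
        _ ≤ K * μ * (μ ^ τ * ν ^ k) := mul_le_mul_of_nonneg_right hKw
            (mul_nonneg (pow_nonneg hμ τ) (pow_nonneg hν k))
        _ = K * μ ^ (τ + 1) * ν ^ k := by ring
  refine ⟨K, fun τ => ?_⟩
  simpa [propagator] using key τ 0

end Recursion

theorem exists_forall_le_of_finite {α : Type*} [Finite α] (f : α → ℝ) : ∃ c, ∀ a, f a ≤ c := by
  obtain ⟨c, hc⟩ := (Set.finite_range f).bddAbove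
  exact ⟨c, fun a => hc ⟨a, rfl⟩⟩

/-- Finitely many values smaller than `μ` are uniformly smaller than `μ`. -/
theorem exists_lt_forall_le_of_finite {α : Type*} [Finite α] {f : α → ℝ} (hf : ∀ a, 0 ≤ f a)
    {μ : ℝ} (hμ : 0 < μ) : ∃ ν, 0 ≤ ν ∧ ν < μ ∧ ∀ a, f a < μ → f a ≤ ν := by
  rcases {a | f a < μ}.eq_empty_or_nonempty with h | h
  · exact ⟨0, le_rfl, hμ, fun a ha => absurd ha (Set.eq_empty_iff_forall_notMem.1 h a)⟩
  · obtain ⟨a, ha, hmax⟩ := Set.exists_max_image _ f (Set.toFinite _) h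
    exact ⟨f a, hf a, ha, hmax⟩

/-! ### Decomposition of the error dynamics -/

section Decomposition

variable {m n : ℕ} {s d : Fin m → ℕ} {A : Matrix (Fin n) (Fin n) ℝ}
  {C : ∀ i, Matrix (Fin (s i)) (Fin n) ℝ} {K : ∀ i, Matrix (Fin n) (Fin (s i)) ℝ}
  (b : ∀ i, OrthonormalBasis (Fin (d i)) ℝ (unobservableSpace A (C i)))

/-- The unobservable space of `(C i, A)` is invariant under `A + K i * C i`. -/
theorem closedLoop_mul_basisMatrix (i : Fin m) :
    (A + K i * C i) * basisMatrix (b i) = basisMatrix (b i) * restrictedBlock A C K b i := by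
  have h : ∀ y, WithLp.toLp 2 (((A + K i * C i) * basisMatrix (b i)) *ᵥ y) ∈
      unobservableSpace A (C i) := fun y => by
    have hy := basisMatrix_mulVec_mem (b i) y
    rw [← mulVec_mulVec, add_mulVec, ← mulVec_mulVec, output_eq_zero_of_mem hy, mulVec_zero,
      add_zero]
    exact mulVec_mem_unobservableSpace hy
  rw [restrictedBlock, Matrix.mul_assoc, ← Matrix.mul_assoc (basisMatrix (b i)),
    basisMatrix_mul_transpose]
  refine Matrix.ext_of_mulVec_single fun k => ?_
  rw [← mulVec_mulVec _ (projectionMatrix _), projectionMatrix_mulVec_eq_self (h _)]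

theorem basisBar_mul_transpose_eq_projectionBar :
    basisBar b * (basisBar b)ᵀ = projectionBar A C :=
  basisBar_mul_transpose b

theorem projectionBar_mul_basisBar : projectionBar A C * basisBar b = basisBar b := by
  rw [← basisBar_mul_transpose_eq_projectionBar b, Matrix.mul_assoc, basisBar_transpose_mul_self,
    Matrix.mul_one]

theorem closedLoop_mul_basisBar :
    closedLoop A C K * basisBar b = basisBar b * restrictedLoop A C K b :=
  blockDiagonalMatrix_mul_basisBar b (closedLoop_mul_basisMatrix b)

theorem projectionBar_mul_self :
    projectionBar A C * projectionBar A C = projectionBar A C := by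
  have b := fun i => stdOrthonormalBasis ℝ (unobservableSpace A (C i))
  rw [← basisBar_mul_transpose_eq_projectionBar b, Matrix.mul_assoc,
    ← Matrix.mul_assoc (basisBar b)ᵀ, basisBar_transpose_mul_self, Matrix.one_mul]

theorem averagingStep_mul_basisBar (G : Digraph (Fin m)) :
    (1 - projectionBar A C * (1 - averagingBar n G)) * basisBar b =
      basisBar b * restrictedAveraging b G := by
  rw [Matrix.sub_mul, Matrix.one_mul, Matrix.mul_sub, Matrix.mul_one, Matrix.sub_mul,
    projectionBar_mul_basisBar, sub_sub_cancel, restrictedAveraging, Matrix.mul_assoc,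
    ← basisBar_mul_transpose_eq_projectionBar b, Matrix.mul_assoc]
  simp only [Matrix.mul_assoc]

/-- The range of `V` is invariant under the error dynamics, which acts on it as `Ã * B ^ q`. -/
theorem errorStep_mul_basisBar (q : ℕ) (G : Digraph (Fin m)) :
    errorStep A C K q G * basisBar b =
      basisBar b * (restrictedLoop A C K b * restrictedAveraging b G ^ q) := by
  have h : (1 - projectionBar A C * (1 - averagingBar n G)) ^ q * basisBar b =
      basisBar b * restrictedAveraging b G ^ q := by
    induction q with
    | zero => rw [pow_zero, pow_zero, Matrix.one_mul, Matrix.mul_one]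
    | succ q ih =>
      rw [pow_succ, Matrix.mul_assoc, averagingStep_mul_basisBar, ← Matrix.mul_assoc, ih,
        Matrix.mul_assoc, ← pow_succ]
  rw [errorStep, Matrix.mul_assoc, h, ← Matrix.mul_assoc, closedLoop_mul_basisBar,
    Matrix.mul_assoc]

/-- The range of `P` is invariant under `Ā`, so `Ā` descends to the complement. -/
theorem complement_mul_closedLoop_mul_complement :
    (1 - projectionBar A C) * closedLoop A C K * (1 - projectionBar A C) =
      (1 - projectionBar A C) * closedLoop A C K := by
  have b := fun i => stdOrthonormalBasis ℝ (unobservableSpace A (C i))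
  have h : (1 - projectionBar A C) * closedLoop A C K * projectionBar A C = 0 := by
    rw [← basisBar_mul_transpose_eq_projectionBar b, ← Matrix.mul_assoc, Matrix.mul_assoc _ _
      (basisBar b), closedLoop_mul_basisBar, basisBar_mul_transpose_eq_projectionBar,
      ← Matrix.mul_assoc _ (basisBar b), Matrix.sub_mul, projectionBar_mul_basisBar, Matrix.one_mul,
      sub_self, Matrix.zero_mul, Matrix.zero_mul]
  rw [Matrix.mul_sub, Matrix.mul_one, h, sub_zero]

/-- Averaging leaves the components orthogonal to the unobservable spaces unchanged. -/
theorem complement_mul_averagingStep_pow (q : ℕ) (G : Digraph (Fin m)) :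
    (1 - projectionBar A C) * (1 - projectionBar A C * (1 - averagingBar n G)) ^ q =
      1 - projectionBar A C := by
  induction q with
  | zero => rw [pow_zero, Matrix.mul_one]
  | succ q ih =>
    rw [pow_succ, ← Matrix.mul_assoc, ih, Matrix.mul_sub, Matrix.mul_one, ← Matrix.mul_assoc,
      Matrix.sub_mul, Matrix.one_mul, projectionBar_mul_self, sub_self, Matrix.zero_mul, sub_zero]

theorem complement_mul_errorStep (q : ℕ) (G : Digraph (Fin m)) :
    (1 - projectionBar A C) * errorStep A C K q G = (1 - projectionBar A C) * closedLoop A C K := by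
  rw [errorStep, ← Matrix.mul_assoc, ← complement_mul_closedLoop_mul_complement, Matrix.mul_assoc,
    complement_mul_averagingStep_pow]

/-- The component of the error outside the unobservable spaces does not depend on the graphs. -/
theorem complement_mul_transition (q : ℕ) (G : ℕ → Digraph (Fin m)) (τ : ℕ) :
    (1 - projectionBar A C) * transition A C K q G τ =
      (1 - projectionBar A C) * closedLoop A C K ^ τ := by
  induction τ with
  | zero => rw [transition, pow_zero]
  | succ τ ih =>
    rw [transition, ← Matrix.mul_assoc, complement_mul_errorStep,
      ← complement_mul_closedLoop_mul_complement, Matrix.mul_assoc, ih, ← Matrix.mul_assoc,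
      complement_mul_closedLoop_mul_complement, Matrix.mul_assoc, ← pow_succ']

/-- The part of the error outside the unobservable spaces decays like the quotient observers. -/
theorem exists_norm_complement_mul_closedLoop_pow_le {r : Fin m → ℕ}
    {Q : ∀ i, Matrix (Fin (r i)) (Fin n) ℝ} (hQ : ∀ i, IsQuotientMatrix A (C i) (Q i))
    {Qinv : ∀ i, Matrix (Fin n) (Fin (r i)) ℝ} (hQinv : ∀ i, Q i * Qinv i = 1) {lam : ℝ}
    (hlam : 0 < lam) {Kbar : ∀ i, Matrix (Fin (r i)) (Fin (s i)) ℝ}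
    (hKbar : ∀ i, IsQuotientGain A (C i) (Q i) lam (Kbar i))
    (hK : ∀ i, K i = Qinv i * Kbar i) :
    ∃ c, ∀ τ, ‖(1 - projectionBar A C) * closedLoop A C K ^ τ‖ ≤ c * lam ^ τ := by
  have hagent : ∀ i, ∃ c, ∀ τ, ‖(1 - projectionMatrix (unobservableSpace A (C i))) *
      (A + K i * C i) ^ τ‖ ≤ c * lam ^ τ := fun i => by
    obtain ⟨Abar, Cbar, hA, hC, hO⟩ := hKbar i
    obtain ⟨c, -, hc⟩ := bound_of_isBigO_nat_atTop hO
    set D := 1 - projectionMatrix (unobservableSpace A (C i)) with hD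
    have hDQ : D = D * Qinv i * Q i := (hQ i).eq_mul_of_forall_mem (hQinv i) fun x hx => by
      rw [hD, sub_mulVec, one_mulVec, projectionMatrix_mulVec_eq_self hx, sub_self]
    have hQL : Q i * (A + K i * C i) = (Abar + Kbar i * Cbar) * Q i := by
      rw [Matrix.mul_add, Matrix.add_mul, hA, hK, Matrix.mul_assoc (Qinv i),
        ← Matrix.mul_assoc (Q i), hQinv, Matrix.one_mul, Matrix.mul_assoc (Kbar i), hC]
    refine ⟨‖D * Qinv i‖ * c * ‖Q i‖, fun τ => ?_⟩
    have hτ := hc (x := τ) (pow_pos hlam τ).ne'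
    rw [Real.norm_of_nonneg (pow_pos hlam τ).le] at hτ
    have hsplit : D * (A + K i * C i) ^ τ = D * Qinv i * ((Abar + Kbar i * Cbar) ^ τ * Q i) := by
      rw [← mul_pow_eq_pow_mul hQL, ← Matrix.mul_assoc, ← hDQ]
    rw [hsplit]
    calc _ ≤ ‖D * Qinv i‖ * (‖(Abar + Kbar i * Cbar) ^ τ‖ * ‖Q i‖) :=
          (l2_opNorm_mul _ _).trans (mul_le_mul_of_nonneg_left (l2_opNorm_mul _ _) (norm_nonneg _))
      _ ≤ ‖D * Qinv i‖ * (c * lam ^ τ * ‖Q i‖) := by gcongr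
      _ = _ := by ring
  choose c hc using hagent
  obtain ⟨e, he, hentry⟩ :=
    exists_l2_opNorm_le_of_abs_entry_le (ι := Fin m × Fin n) (κ := Fin m × Fin n)
  obtain ⟨c₀, hc₀⟩ := exists_forall_le_of_finite fun i => |c i|
  refine ⟨e * max c₀ 0, fun τ => ?_⟩
  have hpow := (pow_pos hlam τ).le
  rw [mul_assoc]
  refine hentry _ _ ?_
  rintro ⟨i, a⟩ ⟨j, a'⟩
  rw [closedLoop, blockDiagonalMatrix_pow, projectionBar, ← blockDiagonalMatrix_one,
    blockDiagonalMatrix_sub, blockDiagonalMatrix_mul, blockDiagonalMatrix_apply]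
  split_ifs with hij
  · refine (abs_entry_le_l2_opNorm _ a a').trans ((hc i τ).trans ?_)
    exact mul_le_mul_of_nonneg_right
      ((le_abs_self _).trans ((hc₀ i).trans (le_max_left _ _))) hpow
  · rw [abs_zero]
    exact mul_nonneg (le_max_right _ _) hpow

/-- In the coordinates `Vᵀ e` and `(1 - P) e` the error dynamics is block triangular, with diagonal
blocks `Ã B ^ q` and `(1 - P) Ā`; the latter decays like `lam ^ τ`. Hence a bound `< μ` on the
former, in any submultiplicative norm, gives the rate `μ`. -/
theorem convergesAsFastAs_transition {lam : ℝ} (hlam : 0 < lam)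
    (hZ : ∃ c, ∀ τ, ‖(1 - projectionBar A C) * closedLoop A C K ^ τ‖ ≤ c * lam ^ τ)
    {N : Matrix (Σ i, Fin (d i)) (Σ i, Fin (d i)) ℝ → ℝ} (hN0 : ∀ X, 0 ≤ N X)
    (hmul : ∀ X Y, N (X * Y) ≤ N X * N Y) (hNc : ∃ c : ℝ, 0 ≤ c ∧ ∀ X, ‖X‖ ≤ c * N X)
    (q : ℕ) {μ : ℝ} (hμ : lam ≤ μ) (G : ℕ → Digraph (Fin m))
    (hG : ∀ τ, N (restrictedLoop A C K b * restrictedAveraging b (G τ) ^ q) < μ) :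
    ConvergesAsFastAs (transition A C K q G) μ := by
  obtain ⟨c, hc0, hc⟩ := hNc
  obtain ⟨z, hz⟩ := hZ
  have hμ0 : 0 < μ := hlam.trans_le hμ
  obtain ⟨ν, hν0, hνμ, hν⟩ := exists_lt_forall_le_of_finite
    (f := fun G : Digraph (Fin m) => N (restrictedLoop A C K b * restrictedAveraging b G ^ q))
    (fun _ => hN0 _) hμ0
  obtain ⟨e, he⟩ := exists_forall_le_of_finite
    fun G : Digraph (Fin m) => ‖(basisBar b)ᵀ * errorStep A C K q G‖
  have hsplit : ∀ M : Matrix (Fin m × Fin n) (Fin m × Fin n) ℝ,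
      M = basisBar b * ((basisBar b)ᵀ * M) + (1 - projectionBar A C) * M := fun M => by
    rw [← Matrix.mul_assoc, basisBar_mul_transpose_eq_projectionBar, ← Matrix.add_mul,
      add_sub_cancel, Matrix.one_mul]
  have hz' : ∀ τ, ‖(1 - projectionBar A C) * transition A C K q G τ‖ ≤ |z| * μ ^ τ := fun τ => by
    rw [complement_mul_transition]
    refine (hz τ).trans ?_
    gcongr
    exact le_abs_self z
  have hY : ∀ τ, (basisBar b)ᵀ * transition A C K q G (τ + 1) =
      restrictedLoop A C K b * restrictedAveraging b (G (τ + 1)) ^ q *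
        ((basisBar b)ᵀ * transition A C K q G τ) +
      (basisBar b)ᵀ * errorStep A C K q (G (τ + 1)) *
        ((1 - projectionBar A C) * transition A C K q G τ) := fun τ => by
    conv_lhs => rw [transition, hsplit (transition A C K q G τ)]
    rw [Matrix.mul_add, Matrix.mul_add, ← Matrix.mul_assoc (errorStep A C K q _) (basisBar b),
      errorStep_mul_basisBar, Matrix.mul_assoc (basisBar b), ← Matrix.mul_assoc _ (basisBar b),
      basisBar_transpose_mul_self, Matrix.one_mul, ← Matrix.mul_assoc _ (errorStep A C K q _)]
  obtain ⟨y, hy⟩ := exists_norm_le_of_recursion hN0 hmul hc0 hc hν0 hνμ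
    (fun τ => hν _ (hG (τ + 1))) (Y := fun τ => (basisBar b)ᵀ * transition A C K q G τ)
    (W := fun τ => (basisBar b)ᵀ * errorStep A C K q (G (τ + 1)) *
      ((1 - projectionBar A C) * transition A C K q G τ)) hY (w := e * |z|) fun τ => by
      rw [mul_assoc]
      exact (l2_opNorm_mul _ _).trans (mul_le_mul (he _) (hz' τ) (norm_nonneg _)
        ((norm_nonneg _).trans (he (G 0))))
  refine IsBigO.of_bound (‖basisBar b‖ * y + |z|) (Eventually.of_forall fun τ => ?_)
  rw [Real.norm_of_nonneg (pow_pos hμ0 τ).le, hsplit (transition A C K q G τ), add_mul]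
  refine (norm_add_le _ _).trans (add_le_add ?_ (hz' τ))
  rw [mul_assoc]
  exact (l2_opNorm_mul _ _).trans (mul_le_mul_of_nonneg_left (hy τ) (norm_nonneg _))

end Decomposition

/-! ### Uniform choices over all neighbor graphs -/

section Uniform

variable {m n : ℕ} {d : Fin m → ℕ} {U : Fin m → Submodule ℝ (EuclideanSpace ℝ (Fin n))}
  (b : ∀ i, OrthonormalBasis (Fin (d i)) ℝ (U i))

theorem eventually_const_mul_pow_lt {c ρ ε : ℝ} (hε : 0 < ε) (hρ0 : 0 ≤ ρ) (hρ : ρ < 1) :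
    ∀ᶠ k : ℕ in atTop, c * ρ ^ k < ε := by
  have h := (tendsto_pow_atTop_nhds_zero_of_lt_one hρ0 hρ).const_mul c
  rw [mul_zero] at h
  exact h.eventually_lt_const hε

theorem exists_forall_mul_pow_lt {c ρ : Digraph (Fin m) → ℝ} {ε : ℝ} (hε : 0 < ε)
    (hρ0 : ∀ G, 0 ≤ ρ G) (hρ : ∀ G, IsNeighborGraph G → ρ G < 1) :
    ∃ k₀ : ℕ, ∀ k ≥ k₀, ∀ G, IsNeighborGraph G → c G * ρ G ^ k < ε :=
  eventually_atTop.1 <| eventually_all.2 fun G => by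
    by_cases hG : IsNeighborGraph G
    · filter_upwards [eventually_const_mul_pow_lt hε (hρ0 G) (hρ G hG)] with k hk _ using hk
    · exact Eventually.of_forall fun k h => absurd h hG

/-- The powers of the restricted averaging matrices tend to zero uniformly over all neighbor graphs:
each is a contraction in its own weighted norm, and there are only finitely many graphs. -/
theorem exists_forall_norm_mul_pow_lt (hU : ⨅ i, U i = ⊥) (hm : 0 < m)
    (X : Matrix (Σ i, Fin (d i)) (Σ i, Fin (d i)) ℝ) {ε : ℝ} (hε : 0 < ε) :
    ∃ p₀ : ℕ, ∀ p ≥ p₀, ∀ G, IsNeighborGraph G → ‖X * restrictedAveraging b G ^ p‖ < ε := by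
  have hgraph : ∀ G : Digraph (Fin m), ∃ c ρ : ℝ, 0 ≤ ρ ∧ (IsNeighborGraph G → ρ < 1 ∧
      ∀ p, ‖X * restrictedAveraging b G ^ p‖ ≤ c * ρ ^ p) := fun G => by
    by_cases hG : IsNeighborGraph G
    · obtain ⟨π, hπ⟩ := hG.exists_isPerronVector hm
      have hω : ∀ k : (Σ i, Fin (d i)), 0 < π k.1 := fun k => hπ.pos k.1
      have h0 := weightedNorm_diagonal_nonneg hω
      have hmul := weightedNorm_diagonal_mul_le hω
      obtain ⟨c, hc0, hc⟩ := exists_norm_le_mul_weightedNorm hω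
      have hlt := weightedNorm_restrictedAveraging_lt_one b hG hπ hU
      rw [weight_eq_diagonal] at hlt
      refine ⟨c * weightedNorm (Matrix.diagonal fun k : (Σ i, Fin (d i)) => π k.1) X, _,
        h0 (restrictedAveraging b G), fun _ => ⟨hlt, fun p => ?_⟩⟩
      rw [mul_assoc]
      exact (hc _).trans
        (mul_le_mul_of_nonneg_left (le_mul_pow_of_submultiplicative h0 hmul X _ p) hc0)
    · exact ⟨0, 0, le_rfl, fun h => absurd h hG⟩
  choose c ρ hρ0 h using hgraph
  obtain ⟨p₀, hp₀⟩ := exists_forall_mul_pow_lt (c := c) hε hρ0 fun G hG => (h G hG).1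
  exact ⟨p₀, fun p hp G hG => ((h G hG).2 p).trans_lt (hp₀ p hp G hG)⟩

end Uniform

/-- Joint observability: only zero is unobservable for all agents. -/
theorem iInf_unobservableSpace_eq_bot {m n : ℕ} {s : Fin m → ℕ} {A : Matrix (Fin n) (Fin n) ℝ}
    {C : ∀ i, Matrix (Fin (s i)) (Fin n) ℝ} (hobs : Observable A (stackedOutput C)) :
    ⨅ i, unobservableSpace A (C i) = ⊥ := by
  rw [eq_bot_iff, ← hobs]
  intro x hx
  refine mem_unobservableSpace.2 fun k hk => funext fun p => ?_
  have h := mem_unobservableSpace.1 ((Submodule.mem_iInf _).1 hx p.1) k hk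
  rw [← mulVec_mulVec] at h ⊢
  exact congrFun h p.2

end DistributedObserver

end

open DistributedObserver in
theorem mainTheorem3 {m n : ℕ} (hm : 1 < m) {s r : Fin m → ℕ}
    (A : Matrix (Fin n) (Fin n) ℝ) (C : ∀ i, Matrix (Fin (s i)) (Fin n) ℝ)
    (hobs : Observable A (stackedOutput C))
    (Q : ∀ i, Matrix (Fin (r i)) (Fin n) ℝ) (hQ : ∀ i, IsQuotientMatrix A (C i) (Q i))
    (Qinv : ∀ i, Matrix (Fin n) (Fin (r i)) ℝ) (hQinv : ∀ i, Q i * Qinv i = 1)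
    (lam : ℝ) (hlam0 : 0 < lam) (hlam1 : lam < 1) :
    -- the quotient pairs exist and are observable
    (∀ i, (∃! Abar : Matrix (Fin (r i)) (Fin (r i)) ℝ, Q i * A = Abar * Q i) ∧
      (∃! Cbar : Matrix (Fin (s i)) (Fin (r i)) ℝ, Cbar * Q i = C i) ∧
      ∀ (Abar : Matrix (Fin (r i)) (Fin (r i)) ℝ) (Cbar : Matrix (Fin (s i)) (Fin (r i)) ℝ),
        Q i * A = Abar * Q i → Cbar * Q i = C i → Observable Abar Cbar) ∧
    -- suitable gains exist
    (∀ i, ∃ Kbar : Matrix (Fin (r i)) (Fin (s i)) ℝ, IsQuotientGain A (C i) (Q i) lam Kbar) ∧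
    ∀ Kbar : ∀ i, Matrix (Fin (r i)) (Fin (s i)) ℝ,
      (∀ i, IsQuotientGain A (C i) (Q i) lam (Kbar i)) →
      ∀ K : ∀ i, Matrix (Fin n) (Fin (s i)) ℝ, (∀ i, K i = Qinv i * Kbar i) →
      -- every sufficiently large number of averaging steps works, for all graph sequences
      (∃ q₀ : ℕ, ∀ q ≥ q₀, ∀ G : ℕ → Digraph (Fin m), (∀ τ, IsNeighborGraph (G τ)) →
        ConvergesAsFastAs (transition A C K q G) lam) ∧
      -- the explicit choices of the number of averaging steps
      ∀ (d : Fin m → ℕ) (b : ∀ i, OrthonormalBasis (Fin (d i)) ℝ (unobservableSpace A (C i))),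
        (∀ i, (A + K i * C i) * basisMatrix (b i) =
          basisMatrix (b i) * restrictedBlock A C K b i) ∧
        -- weighted two-norm, constant graph
        (∀ G : Digraph (Fin m), IsNeighborGraph G →
          (∃ π, IsPerronVector G π) ∧
          ∀ π, IsPerronVector G π →
            (weight b π).PosDef ∧
            weightedNorm (weight b π) (restrictedAveraging b G) < 1 ∧
            (∃ q₀ : ℕ, ∀ q ≥ q₀, weightedNorm (weight b π) (restrictedLoop A C K b) *
              weightedNorm (weight b π) (restrictedAveraging b G) ^ q < lam) ∧
            (∀ q : ℕ,
              weightedNorm (weight b π) (restrictedLoop A C K b * restrictedAveraging b G ^ q) ≤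
                weightedNorm (weight b π) (restrictedLoop A C K b) *
                  weightedNorm (weight b π) (restrictedAveraging b G) ^ q) ∧
            ∀ (q : ℕ) (μ : ℝ), lam ≤ μ →
              weightedNorm (weight b π)
                (restrictedLoop A C K b * restrictedAveraging b G ^ q) < μ →
              ConvergesAsFastAs (transition A C K q fun _ => G) μ) ∧
        -- two-norm, time-varying graph
        ((∃ p₀ : ℕ, ∀ p ≥ p₀, ∀ G : Digraph (Fin m), IsNeighborGraph G →
            ‖restrictedAveraging b G ^ p‖ < 1) ∧
          (∀ p : ℕ, (∀ G : Digraph (Fin m), IsNeighborGraph G →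
              ‖restrictedAveraging b G ^ p‖ < 1) →
            ∃ k₀ : ℕ, ∀ k ≥ k₀, ∀ G : Digraph (Fin m), IsNeighborGraph G →
              ‖restrictedLoop A C K b * (restrictedAveraging b G ^ p) ^ k‖ < lam) ∧
          ∀ (p k : ℕ) (μ : ℝ), lam ≤ μ →
            ∀ G : ℕ → Digraph (Fin m), (∀ τ, IsNeighborGraph (G τ)) →
              (∀ τ, ‖restrictedLoop A C K b * (restrictedAveraging b (G τ) ^ p) ^ k‖ < μ) →
              ConvergesAsFastAs (transition A C K (p * k) G) μ) ∧
        -- mixed matrix norm, constant or time-varying graph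
        ((∀ p ≥ (m - 1) ^ 2, ∀ G : Digraph (Fin m), IsNeighborGraph G →
            mixedNorm (restrictedAveraging b G ^ p) < 1) ∧
          (∀ p ≥ (m - 1) ^ 2, ∃ k₀ : ℕ, ∀ k ≥ k₀,
            ∀ G : Digraph (Fin m), IsNeighborGraph G →
              mixedNorm (restrictedLoop A C K b) *
                mixedNorm (restrictedAveraging b G ^ p) ^ k < lam) ∧
          (∀ (p k : ℕ) (G : Digraph (Fin m)), IsNeighborGraph G →
            mixedNorm (restrictedLoop A C K b * (restrictedAveraging b G ^ p) ^ k) ≤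
              mixedNorm (restrictedLoop A C K b) *
                mixedNorm (restrictedAveraging b G ^ p) ^ k) ∧
          ∀ (p k : ℕ) (μ : ℝ), lam ≤ μ →
            ∀ G : ℕ → Digraph (Fin m), (∀ τ, IsNeighborGraph (G τ)) →
              (∀ τ, mixedNorm
                (restrictedLoop A C K b * (restrictedAveraging b (G τ) ^ p) ^ k) < μ) →
              ConvergesAsFastAs (transition A C K (p * k) G) μ) := by
  have hm0 : 0 < m := by omega
  have hU := iInf_unobservableSpace_eq_bot hobs
  refine ⟨fun i => ⟨(hQ i).existsUnique_state (hQinv i), (hQ i).existsUnique_output (hQinv i),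
    fun Abar Cbar => (hQ i).observable (hQinv i)⟩, fun i => ?_, fun Kbar hKbar K hK => ?_⟩
  · obtain ⟨Abar, hA, -⟩ := (hQ i).existsUnique_state (hQinv i)
    obtain ⟨Cbar, hC, -⟩ := (hQ i).existsUnique_output (hQinv i)
    obtain ⟨Kbar, hKbar⟩ := ((hQ i).observable (hQinv i) hA hC).exists_convergesAsFastAs lam
    exact ⟨Kbar, Abar, Cbar, hA, hC, hKbar⟩
  have hZ := exists_norm_complement_mul_closedLoop_pow_le hQ hQinv hlam0 hKbar hK
  refine ⟨?_, fun d b => ⟨closedLoop_mul_basisMatrix b, fun G hG => ⟨hG.exists_isPerronVector hm0,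
    fun π hπ => ?_⟩, ⟨?_, fun p hp => ?_, fun p k μ hμ G _ hlt => ?_⟩,
    fun p hp G hG => mixedNorm_restrictedAveraging_pow_lt_one b hG hU hm0 hp, fun p hp => ?_,
    fun p k G _ => le_mul_pow_of_submultiplicative mixedNorm_nonneg mixedNorm_mul_le _ _ k,
    fun p k μ hμ G _ hlt => ?_⟩⟩
  -- the claim about `q₀` involves no basis; any orthonormal bases will do
  · let b := fun i => stdOrthonormalBasis ℝ (unobservableSpace A (C i))
    obtain ⟨q₀, hq₀⟩ := exists_forall_norm_mul_pow_lt b hU hm0 (restrictedLoop A C K b) hlam0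
    exact ⟨q₀, fun q hq G hG => convergesAsFastAs_transition b hlam0 hZ norm_nonneg l2_opNorm_mul
      ⟨1, zero_le_one, fun X => (one_mul _).ge⟩ q le_rfl G fun τ => hq₀ q hq _ (hG τ)⟩
  · have hpos := posDef_weight b hπ.pos
    have hlt := weightedNorm_restrictedAveraging_lt_one b hG hπ hU
    rw [weight_eq_diagonal] at hpos hlt ⊢
    have hω : ∀ k : (Σ i, Fin (d i)), 0 < π k.1 := fun k => hπ.pos k.1
    have h0 := weightedNorm_diagonal_nonneg hω
    have hmul := weightedNorm_diagonal_mul_le hω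
    have hc := exists_norm_le_mul_weightedNorm hω
    exact ⟨hpos, hlt, eventually_atTop.1 (eventually_const_mul_pow_lt hlam0 (h0 _) hlt),
      le_mul_pow_of_submultiplicative h0 hmul _ _,
      fun q μ hμ hq => convergesAsFastAs_transition b hlam0 hZ h0 hmul hc q hμ _ fun _ => hq⟩
  · obtain ⟨p₀, hp₀⟩ := exists_forall_norm_mul_pow_lt b hU hm0 1 one_pos
    exact ⟨p₀, fun p hp G hG => by simpa only [one_mul] using hp₀ p hp G hG⟩
  · obtain ⟨k₀, hk₀⟩ := exists_forall_mul_pow_lt (c := fun _ => ‖restrictedLoop A C K b‖)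
      hlam0 (fun G => norm_nonneg (restrictedAveraging b G ^ p)) hp
    exact ⟨k₀, fun k hk G hG => (le_mul_pow_of_submultiplicative norm_nonneg l2_opNorm_mul
      (restrictedLoop A C K b) _ k).trans_lt (hk₀ k hk G hG)⟩
  · refine convergesAsFastAs_transition b hlam0 hZ norm_nonneg l2_opNorm_mul
      ⟨1, zero_le_one, fun X => (one_mul _).ge⟩ (p * k) hμ G fun τ => ?_
    rw [pow_mul]
    exact hlt τ
  · exact exists_forall_mul_pow_lt hlam0 (fun G => mixedNorm_nonneg (restrictedAveraging b G ^ p))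
      fun G hG => mixedNorm_restrictedAveraging_pow_lt_one b hG hU hm0 hp
  · refine convergesAsFastAs_transition b hlam0 hZ mixedNorm_nonneg mixedNorm_mul_le
      exists_norm_le_mul_mixedNorm (p * k) hμ G fun τ => ?_
    rw [pow_mul]
    exact hlt τ
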